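/- For an integer $n\ge 1$ let $\mathcal C_n(\mathbb R)$ be the unital associative $\mathbb R$-algebra generated by $i_1,\dots,i_{n-1}$ subject to $i_h^2=-1$ and $i_hi_k=-i_ki_h$ for $h\ne k$, let $\mathcal C_n(\mathbb Z)$ be its subring generated by $i_1,\dots,i_{n-1}$, and let $a\mapsto a^*$ be the linear anti-automorphism of $\mathcal C_n(\mathbb R)$ fixing every $i_h$. Let $\mathrm V^n(\mathbb R)$ be the real span of $1,i_1,\dots,i_{n-1}$, let $\Gamma_n(\mathbb R)$ be the multiplicative group of all products of invertible elements of $\mathrm V^n(\mathbb R)$, and put $\Gamma_n(\mathbb Z)=\mathcal C_n(\mathbb Z)\cap\Gamma_n(\mathbb R)$. Let $\operatorname{SL}_+(\Gamma_n(\mathbb R))$ be the group of matrices $\begin{pmatrix}a&b\\c&d\end{pmatrix}$ with $a,b,c,d\in\Gamma_n(\mathbb R)\cup\{0\}$, $ad^*-bc^*=1$ and $ab^*,\,cd^*,\,c^*a,\,d^*b\in\mathrm V^n(\mathbb R)$, and let the higher modular group $\operatorname{SL}_+(\Gamma_n(\mathbb Z))$ be its subgroup of matrices with all entries in $\Gamma_n(\mathbb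 Z)\cup\{0\}$. A group $G$ is called a non-trivial amalgamated product over $H$, where $H$ is a group with a given homomorphism $e:H\to G$, if there are groups $G_1,G_2$, injective but not surjective homomorphisms $f_1:H\to G_1$ and $f_2:H\to G_2$, and an isomorphism $\varphi:G_1*_HG_2\to G$, where $G_1*_HG_2$ is the quotient of the free product $G_1*G_2$ by the normal subgroup generated by all $f_1(h)f_2(h)^{-1}$, $h\in H$, such that $\varphi$ maps the class of $f_1(h)$ to $e(h)$ for every $h\in H$. **Corollary 5.7.** For $2\le n\le 4$, the group $\operatorname{SL}_+(\Gamma_n(\mathbb Z))$ is a non-trivial amalgamated product over $\operatorname{SL}_+(\Gamma_{n-1}(\mathbb Z))$, embedded through the inclusion $\mathcal C_{n-1}(\mathbb R)\subseteq\mathcal C_n(\mathbb R)$, $i_h\mapsto i_h$. For $n=1$, the group $\operatorname{SL}_+(\Gamma_1(\mathbb Z))$ is a non-trivial amalgamated product over its subgroup $\{\pm I\}\cong C_2$. -/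

import Mathlib

open scoped Matrix

/-! ### Real Clifford algebras -/

/-- The quadratic form `-(x₁² + ⋯ + x_{n-1}²)` on `ℝ^{n-1}`. -/
noncomputable def cliffordForm (n : ℕ) : QuadraticForm ℝ (Fin (n - 1) → ℝ) :=
  QuadraticMap.weightedSumSquares ℝ (fun _ : Fin (n - 1) => (-1 : ℝ))

/-- The Clifford algebra `𝒞ₙ(ℝ)` (for `n ≥ 1`): the unital associative `ℝ`-algebra generated by
`n - 1` elements `i_h` with `i_h² = -1` and `i_h i_k = - i_k i_h` for `h ≠ k`. -/
abbrev Cliff (n : ℕ) : Type := CliffordAlgebra (cliffordForm n)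

namespace Cliff

/-- The generators `i_h` of the Clifford algebra (indexed from `0`). -/
noncomputable def gen (n : ℕ) (h : Fin (n - 1)) : Cliff n :=
  CliffordAlgebra.ι (cliffordForm n) (Pi.single h 1)

/-- `a ↦ a*`: the anti-automorphism reversing the order of the factors in products of the
generators. -/
noncomputable def rev {n : ℕ} (a : Cliff n) : Cliff n := CliffordAlgebra.reverse a

/-- The space of vectors `Vⁿ(ℝ)`, spanned by `i₀ = 1, i₁, …, i_{n-1}`. -/
noncomputable def V (n : ℕ) : Submodule ℝ (Cliff n) :=
  Submodule.span ℝ (insert 1 (Set.range (gen n)))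

/-- The Clifford group `Γₙ(ℝ)`: the group of all products of invertible vectors. -/
noncomputable def Gam (n : ℕ) : Subgroup (Cliff n)ˣ :=
  Subgroup.closure {u | (u : Cliff n) ∈ V n}

/-- The set `Γₙ(ℝ) ∪ {0}`, as a subset of `𝒞ₙ(ℝ)`. -/
def Gam0 (n : ℕ) : Set (Cliff n) := {a | a = 0 ∨ ∃ u ∈ Gam n, (u : Cliff n) = a}

/-- The integral Clifford algebra `𝒞ₙ(ℤ)` inside `𝒞ₙ(ℝ)`: the subring generated by
`i₁, …, i_{n-1}`. -/
noncomputable def integral (n : ℕ) : Subring (Cliff n) := Subring.closure (Set.range (gen n))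

/-! ### Basic facts needed to see that the matrix groups below are groups -/

section facts

variable {n : ℕ}

@[simp] theorem rev_rev (a : Cliff n) : rev (rev a) = a := CliffordAlgebra.reverse_reverse a

@[simp] theorem rev_mul (a b : Cliff n) : rev (a * b) = rev b * rev a :=
  CliffordAlgebra.reverse.map_mul a b

@[simp] theorem rev_add (a b : Cliff n) : rev (a + b) = rev a + rev b := map_add _ a b

@[simp] theorem rev_sub (a b : Cliff n) : rev (a - b) = rev a - rev b := map_sub _ a b

@[simp] theorem rev_neg (a : Cliff n) : rev (-a) = -rev a := map_neg _ a

@[simp] theorem rev_zero : rev (0 : Cliff n) = 0 := map_zero _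

@[simp] theorem rev_one : rev (1 : Cliff n) = 1 := CliffordAlgebra.reverse.map_one

theorem mem_V {x : Cliff n} :
    x ∈ V n ↔ ∃ (r : ℝ) (v : Fin (n - 1) → ℝ),
      x = algebraMap ℝ _ r + CliffordAlgebra.ι (cliffordForm n) v := by
  constructor
  · intro hx
    induction hx using Submodule.span_induction with
    | mem x hx =>
      rcases hx with rfl | ⟨h, rfl⟩
      · exact ⟨1, 0, by simp⟩
      · exact ⟨0, Pi.single h 1, by simp [gen]⟩
    | zero => exact ⟨0, 0, by simp⟩
    | add x y _ _ hx hy =>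
      obtain ⟨r, v, rfl⟩ := hx
      obtain ⟨s, w, rfl⟩ := hy
      exact ⟨r + s, v + w, by simp only [map_add]; abel⟩
    | smul c x _ hx =>
      obtain ⟨r, v, rfl⟩ := hx
      exact ⟨c * r, c • v, by
        rw [smul_add, map_smul, Algebra.algebraMap_eq_smul_one, Algebra.algebraMap_eq_smul_one,
          smul_smul]⟩
  · rintro ⟨r, v, rfl⟩
    refine add_mem ?_ ?_
    · rw [Algebra.algebraMap_eq_smul_one]
      exact Submodule.smul_mem _ _ (Submodule.subset_span (Set.mem_insert _ _))
    · have hv : v = ∑ h, v h • (Pi.single h 1 : Fin (n - 1) → ℝ) := by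
        ext j; simp [Pi.single_apply]
      rw [hv, map_sum]
      refine Submodule.sum_mem _ fun h _ => ?_
      rw [map_smul]
      exact Submodule.smul_mem _ _
        (Submodule.subset_span (Set.mem_insert_of_mem _ ⟨h, rfl⟩))

theorem rev_of_mem_V {x : Cliff n} (hx : x ∈ V n) : rev x = x := by
  obtain ⟨r, v, rfl⟩ := mem_V.1 hx
  simp [rev]

theorem sandwich_mem_V {x y : Cliff n} (hx : x ∈ V n) (hy : y ∈ V n) : x * y * x ∈ V n := by
  obtain ⟨r, v, rfl⟩ := mem_V.1 hx
  obtain ⟨s, w, rfl⟩ := mem_V.1 hy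
  have h1 := CliffordAlgebra.ι_sq_scalar (cliffordForm n) v
  have h2 := CliffordAlgebra.ι_mul_ι_add_swap (Q := cliffordForm n) v w
  have h3 := CliffordAlgebra.ι_mul_ι_mul_ι (Q := cliffordForm n) v w
  have e : (algebraMap ℝ (Cliff n) r + CliffordAlgebra.ι _ v) *
      (algebraMap ℝ (Cliff n) s + CliffordAlgebra.ι _ w) *
      (algebraMap ℝ (Cliff n) r + CliffordAlgebra.ι _ v) =
      (r * s * r) • 1 + (2 * r * s) • CliffordAlgebra.ι _ v +
      s • (CliffordAlgebra.ι (cliffordForm n) v * CliffordAlgebra.ι _ v) +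
      (r * r) • CliffordAlgebra.ι _ w + r • (CliffordAlgebra.ι (cliffordForm n) v *
        CliffordAlgebra.ι _ w + CliffordAlgebra.ι _ w * CliffordAlgebra.ι _ v) +
      CliffordAlgebra.ι (cliffordForm n) v * CliffordAlgebra.ι _ w * CliffordAlgebra.ι _ v := by
    simp only [Algebra.algebraMap_eq_smul_one, add_mul, mul_add, smul_mul_assoc, mul_smul_comm,
      one_mul, mul_one, smul_add, smul_smul]
    module
  rw [e, h1, h2, h3]
  have hι : ∀ u, CliffordAlgebra.ι (cliffordForm n) u ∈ V n :=
    fun u => mem_V.2 ⟨0, u, by simp⟩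
  have ha : ∀ t, algebraMap ℝ (Cliff n) t ∈ V n := fun t => mem_V.2 ⟨t, 0, by simp⟩
  have h1' : (1 : Cliff n) ∈ V n := by simpa using ha 1
  exact add_mem (add_mem (add_mem (add_mem (add_mem (Submodule.smul_mem _ _ h1')
    (Submodule.smul_mem _ _ (hι _))) (Submodule.smul_mem _ _ (ha _)))
    (Submodule.smul_mem _ _ (hι _))) (Submodule.smul_mem _ _ (ha _))) (hι _)

/-- The polarised form of `sandwich_mem_V`. -/
theorem sandwich_add_mem_V {y s v : Cliff n} (hy : y ∈ V n) (hs : s ∈ V n) (hv : v ∈ V n) :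
    y * s * v + v * s * y ∈ V n := by
  have e : y * s * v + v * s * y =
      (y + v) * s * (y + v) - y * s * y - v * s * v := by noncomm_ring
  rw [e]
  exact sub_mem (sub_mem (sandwich_mem_V (add_mem hy hv) hs) (sandwich_mem_V hy hs))
    (sandwich_mem_V hv hs)

theorem form_nonpos (v : Fin (n - 1) → ℝ) :
    cliffordForm n v ≤ 0 ∧ (cliffordForm n v = 0 → v = 0) := by
  have e : cliffordForm n v = -∑ h, v h * v h := by
    simp [cliffordForm, QuadraticMap.weightedSumSquares_apply]
  have h0 : 0 ≤ ∑ h, v h * v h := Finset.sum_nonneg fun h _ => mul_self_nonneg _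
  refine ⟨by rw [e]; linarith, fun h => ?_⟩
  rw [e, neg_eq_zero, Finset.sum_eq_zero_iff_of_nonneg fun h _ => mul_self_nonneg _] at h
  ext j
  simpa using h j (Finset.mem_univ j)

/-- Every non-zero vector has an inverse that is again a vector. -/
theorem exists_inv_of_mem_V {x : Cliff n} (hx : x ∈ V n) (h0 : x ≠ 0) :
    ∃ y ∈ V n, x * y = 1 ∧ y * x = 1 := by
  obtain ⟨r, v, rfl⟩ := mem_V.1 hx
  have hpos : r * r - cliffordForm n v ≠ 0 := by
    intro h
    have h1 := form_nonpos v
    have h2 : r = 0 := by nlinarith [mul_self_nonneg r]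
    have h3 : v = 0 := h1.2 (by subst h2; linarith)
    subst h2 h3
    simp at h0
  have h1 := CliffordAlgebra.ι_sq_scalar (cliffordForm n) v
  rw [Algebra.algebraMap_eq_smul_one] at h1
  refine ⟨(r * r - cliffordForm n v)⁻¹ • (algebraMap ℝ _ r - CliffordAlgebra.ι _ v), ?_, ?_, ?_⟩
  · exact Submodule.smul_mem _ _ (mem_V.2 ⟨r, -v, by rw [map_neg, sub_eq_add_neg]⟩)
  · rw [mul_smul_comm, inv_smul_eq_iff₀ hpos]
    simp only [Algebra.algebraMap_eq_smul_one, add_mul, mul_sub, smul_mul_assoc, mul_smul_comm,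
      one_mul, mul_one, h1]
    module
  · rw [smul_mul_assoc, inv_smul_eq_iff₀ hpos]
    simp only [Algebra.algebraMap_eq_smul_one, sub_mul, mul_add, smul_mul_assoc, mul_smul_comm,
      one_mul, mul_one, h1]
    module

theorem inv_mem_V {u : (Cliff n)ˣ} (hu : (u : Cliff n) ∈ V n) :
    ((u⁻¹ : (Cliff n)ˣ) : Cliff n) ∈ V n := by
  by_cases h0 : (u : Cliff n) = 0
  · have : Subsingleton (Cliff n) := by
      refine subsingleton_of_zero_eq_one ?_
      rw [← u.mul_inv, h0, zero_mul]
    rw [Subsingleton.elim ((u⁻¹ : (Cliff n)ˣ) : Cliff n) 0]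
    exact zero_mem _
  · obtain ⟨y, hy, hxy, -⟩ := exists_inv_of_mem_V hu h0
    rwa [Units.inv_eq_of_mul_eq_one_right hxy]

theorem conj_mem_V {u : (Cliff n)ˣ} (hu : u ∈ Gam n) {x : Cliff n} (hx : x ∈ V n) :
    (u : Cliff n) * x * rev (u : Cliff n) ∈ V n := by
  have key : ∀ x ∈ V n, (u : Cliff n) * x * rev (u : Cliff n) ∈ V n ∧
      ((u⁻¹ : (Cliff n)ˣ) : Cliff n) * x * rev ((u⁻¹ : (Cliff n)ˣ) : Cliff n) ∈ V n := by
    induction hu using Subgroup.closure_induction with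
    | mem u hu =>
      intro x hx
      have hu' := inv_mem_V hu
      exact ⟨by rw [rev_of_mem_V hu]; exact sandwich_mem_V hu hx,
        by rw [rev_of_mem_V hu']; exact sandwich_mem_V hu' hx⟩
    | one => intro x hx; simpa using hx
    | mul u w _ _ hu hw =>
      intro x hx
      refine ⟨?_, ?_⟩
      · simpa [mul_assoc] using (hu _ (hw _ hx).1).1
      · simpa [mul_assoc] using (hw _ (hu _ hx).2).2
    | inv u _ hu => intro x hx; exact ⟨(hu x hx).2, by simpa using (hu x hx).1⟩
  exact (key x hx).1

theorem conj_mem_V' {a : Cliff n} (ha : a ∈ Gam0 n) {x : Cliff n} (hx : x ∈ V n) :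
    a * x * rev a ∈ V n := by
  rcases ha with rfl | ⟨u, hu, rfl⟩
  · simp
  · exact conj_mem_V hu hx

theorem zero_mem_Gam0 : (0 : Cliff n) ∈ Gam0 n := Or.inl rfl

theorem one_mem_Gam0 : (1 : Cliff n) ∈ Gam0 n := Or.inr ⟨1, one_mem _, rfl⟩

theorem mul_mem_Gam0 {a b : Cliff n} (ha : a ∈ Gam0 n) (hb : b ∈ Gam0 n) : a * b ∈ Gam0 n := by
  rcases ha with rfl | ⟨u, hu, rfl⟩
  · rw [zero_mul]; exact zero_mem_Gam0
  rcases hb with rfl | ⟨w, hw, rfl⟩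
  · rw [mul_zero]; exact zero_mem_Gam0
  exact Or.inr ⟨u * w, mul_mem hu hw, rfl⟩

theorem mem_Gam0_of_mem_V {x : Cliff n} (hx : x ∈ V n) : x ∈ Gam0 n := by
  by_cases h0 : x = 0
  · exact Or.inl h0
  · obtain ⟨y, -, hxy, hyx⟩ := exists_inv_of_mem_V hx h0
    exact Or.inr ⟨⟨x, y, hxy, hyx⟩, Subgroup.subset_closure hx, rfl⟩

theorem one_mem_V : (1 : Cliff n) ∈ V n := Submodule.subset_span (Set.mem_insert _ _)

theorem neg_mem_Gam0 {a : Cliff n} (ha : a ∈ Gam0 n) : -a ∈ Gam0 n := by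
  rw [← neg_one_mul]
  exact mul_mem_Gam0 (mem_Gam0_of_mem_V (neg_mem one_mem_V)) ha

theorem rev_mem_Gam0 {a : Cliff n} (ha : a ∈ Gam0 n) : rev a ∈ Gam0 n := by
  rcases ha with rfl | ⟨u, hu, rfl⟩
  · rw [rev_zero]; exact zero_mem_Gam0
  have key : rev (u : Cliff n) ∈ Gam0 n ∧ rev ((u⁻¹ : (Cliff n)ˣ) : Cliff n) ∈ Gam0 n := by
    induction hu using Subgroup.closure_induction with
    | mem u hu =>
      have hu' := inv_mem_V hu
      rw [rev_of_mem_V hu, rev_of_mem_V hu']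
      exact ⟨mem_Gam0_of_mem_V hu, mem_Gam0_of_mem_V hu'⟩
    | one => simpa using one_mem_Gam0
    | mul u w _ _ hu hw =>
      simp only [Units.val_mul, rev_mul, mul_inv_rev]
      exact ⟨mul_mem_Gam0 hw.1 hu.1, mul_mem_Gam0 hu.2 hw.2⟩
    | inv u _ hu => exact ⟨hu.2, by simpa using hu.1⟩
  exact key.1

theorem rev_mem_integral {a : Cliff n} (ha : a ∈ integral n) : rev a ∈ integral n := by
  induction ha using Subring.closure_induction with
  | mem x hx =>
    obtain ⟨h, rfl⟩ := hx
    have : rev (gen n h) = gen n h := by simp [rev, gen]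
    rw [this]
    exact Subring.subset_closure ⟨h, rfl⟩
  | zero => rw [rev_zero]; exact zero_mem _
  | one => rw [rev_one]; exact one_mem _
  | add x y _ _ hx hy => rw [rev_add]; exact add_mem hx hy
  | neg x _ hx => rw [rev_neg]; exact neg_mem hx
  | mul x y _ _ hx hy => rw [rev_mul]; exact mul_mem hy hx

/-- For a unit `u` of the Clifford group, `u b* ∈ V` implies `u⁻¹ b ∈ V`. -/
theorem inv_mul_mem_V {u : (Cliff n)ˣ} (hu : u ∈ Gam n) {b : Cliff n}
    (h : (u : Cliff n) * rev b ∈ V n) : ((u⁻¹ : (Cliff n)ˣ) : Cliff n) * b ∈ V n := by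
  have h1 := conj_mem_V (inv_mem hu) h
  rw [← mul_assoc, Units.inv_mul, one_mul, ← rev_mul] at h1
  have h2 := rev_of_mem_V h1
  rw [rev_rev] at h2
  rwa [h2]

/-- For a unit `u` of the Clifford group, `u* b ∈ V` implies `b u⁻¹ ∈ V`. -/
theorem mul_inv_mem_V {u : (Cliff n)ˣ} (hu : u ∈ Gam n) {b : Cliff n}
    (h : rev (u : Cliff n) * b ∈ V n) : b * ((u⁻¹ : (Cliff n)ˣ) : Cliff n) ∈ V n := by
  have h0 : rev ((u⁻¹ : (Cliff n)ˣ) : Cliff n) ∈ Gam0 n :=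
    rev_mem_Gam0 (Or.inr ⟨_, inv_mem hu, rfl⟩)
  have h1 := conj_mem_V' h0 h
  rwa [rev_rev, ← mul_assoc, ← rev_mul, Units.mul_inv, rev_one, one_mul] at h1

/-- `a p + b q ∈ Γ ∪ {0}` if `a b* ∈ V` and `q* p ∈ V`. -/
theorem add_mem_Gam0 {a b p q : Cliff n} (ha : a ∈ Gam0 n) (hb : b ∈ Gam0 n)
    (hp : p ∈ Gam0 n) (hq : q ∈ Gam0 n) (hab : a * rev b ∈ V n) (hqp : rev q * p ∈ V n) :
    a * p + b * q ∈ Gam0 n := by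
  have hap := mul_mem_Gam0 ha hp
  have hbq := mul_mem_Gam0 hb hq
  rcases ha with rfl | ⟨u, hu, rfl⟩
  · simpa using hbq
  rcases hq with rfl | ⟨w, hw, rfl⟩
  · simpa using hap
  have e : (u : Cliff n) * p + b * w =
      u * (p * ((w⁻¹ : (Cliff n)ˣ) : Cliff n) + ((u⁻¹ : (Cliff n)ˣ) : Cliff n) * b) * w := by
    simp [mul_add, add_mul, mul_assoc]
  rw [e]
  exact mul_mem_Gam0 (mul_mem_Gam0 (Or.inr ⟨u, hu, rfl⟩)
    (mem_Gam0_of_mem_V (add_mem (mul_inv_mem_V hw hqp) (inv_mul_mem_V hu hab))))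
    (Or.inr ⟨w, hw, rfl⟩)

theorem comm_of_mem_V {a b : Cliff n} (h : a * rev b ∈ V n) : b * rev a = a * rev b := by
  simpa using rev_of_mem_V h

theorem comm_of_mem_V' {a b : Cliff n} (h : rev a * b ∈ V n) : rev b * a = rev a * b := by
  simpa using rev_of_mem_V h

/-- The row `(a, b) · [[p, q], [r, s]]` again satisfies the vector condition. -/
theorem row_mem_V {a b p q r s : Cliff n} (ha : a ∈ Gam0 n) (hb : b ∈ Gam0 n)
    (hr : r ∈ Gam0 n) (hab : a * rev b ∈ V n) (hdet : p * rev s - q * rev r = 1)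
    (hpq : p * rev q ∈ V n) (hrs : r * rev s ∈ V n) (hrp : rev r * p ∈ V n) :
    (a * p + b * r) * rev (a * q + b * s) ∈ V n := by
  have hdet' : p * rev s = 1 + q * rev r := by rw [← hdet]; abel
  have e : (a * p + b * r) * rev (a * q + b * s) =
      a * (p * rev q) * rev a + b * (r * rev s) * rev b + a * rev b +
        (a * (q * rev r) * rev b + b * (r * rev q) * rev a) := by
    calc (a * p + b * r) * rev (a * q + b * s)
        = a * (p * rev q) * rev a + b * (r * rev s) * rev b + (a * (p * rev s) * rev b +
          b * (r * rev q) * rev a) := by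
          simp only [rev_add, rev_mul]; noncomm_ring
      _ = _ := by rw [hdet']; noncomm_ring
  rw [e]
  refine add_mem (add_mem (add_mem (conj_mem_V' ha hpq) (conj_mem_V' hb hrs)) hab) ?_
  rcases hb with rfl | ⟨u, hu, rfl⟩
  · simp
  rcases hr with rfl | ⟨w, hw, rfl⟩
  · simp
  have hy : ((u⁻¹ : (Cliff n)ˣ) : Cliff n) * a ∈ V n :=
    inv_mul_mem_V hu (by rw [comm_of_mem_V hab]; exact hab)
  have ht : p * ((w⁻¹ : (Cliff n)ˣ) : Cliff n) ∈ V n := mul_inv_mem_V hw hrp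
  have hrs' := comm_of_mem_V hrs
  generalize hy' : ((u⁻¹ : (Cliff n)ˣ) : Cliff n) * a = y at hy
  generalize ht' : p * ((w⁻¹ : (Cliff n)ˣ) : Cliff n) = t at ht
  have ea : a = u * y := by rw [← hy']; simp
  have ep : p = t * w := by rw [← ht']; simp
  have era : rev a = y * rev (u : Cliff n) := by rw [ea, rev_mul, rev_of_mem_V hy]
  have e1 : q * rev (w : Cliff n) = t * (w * rev s) - 1 := by
    rw [← mul_assoc, ← ep, hdet']; abel
  have e2 : (w : Cliff n) * rev q = (w * rev s) * t - 1 := by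
    have := congrArg rev e1
    simpa [rev_of_mem_V ht, hrs'] using this
  have e3 : a * (q * rev (w : Cliff n)) * rev (u : Cliff n) + u * (w * rev q) * rev a =
      u * ((y * t * (w * rev s) + (w * rev s) * t * y) - 2 • y) * rev (u : Cliff n) := by
    rw [e1, e2, era, ea]; noncomm_ring
  rw [e3]
  exact conj_mem_V hu (sub_mem (sandwich_add_mem_V hy ht hrs) (nsmul_mem hy 2))

end facts

end Cliff

/-! ### The groups `SL₊(Γₙ(ℝ))` and `SL₊(Γₙ(ℤ))` -/

open Cliff

/-- The conditions defining `SL₊(Γₙ(ℝ))`. -/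
structure IsSLPlus {n : ℕ} (M : Matrix (Fin 2) (Fin 2) (Cliff n)) : Prop where
  entries : ∀ i j, M i j ∈ Gam0 n
  det_eq : M 0 0 * rev (M 1 1) - M 0 1 * rev (M 1 0) = 1
  row₀ : M 0 0 * rev (M 0 1) ∈ V n
  row₁ : M 1 0 * rev (M 1 1) ∈ V n
  col₀ : rev (M 1 0) * M 0 0 ∈ V n
  col₁ : rev (M 1 1) * M 0 1 ∈ V n

namespace IsSLPlus

variable {n : ℕ} {M N : Matrix (Fin 2) (Fin 2) (Cliff n)}

/-- The explicit inverse of a matrix in `SL₊(Γₙ(ℝ))`. -/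
noncomputable def adj (M : Matrix (Fin 2) (Fin 2) (Cliff n)) : Matrix (Fin 2) (Fin 2) (Cliff n) :=
  !![rev (M 1 1), -rev (M 0 1); -rev (M 1 0), rev (M 0 0)]

theorem mul_adj (h : IsSLPlus M) : M * adj M = 1 := by
  have h1 := comm_of_mem_V h.row₀
  have h2 := comm_of_mem_V h.row₁
  have h3 := h.det_eq
  have h4 := congrArg rev h3
  simp only [rev_sub, rev_mul, rev_rev, rev_one] at h4
  ext i j
  fin_cases i <;> fin_cases j <;>
    simp [adj, Matrix.mul_apply, Fin.sum_univ_two, h1, h2]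
  · rw [← sub_eq_add_neg]; exact h3
  · rw [neg_add_eq_sub]; exact h4

theorem adj_mul_det (h : IsSLPlus M) :
    rev (M 1 1) * M 0 0 - rev (M 0 1) * M 1 0 = 1 := by
  have h1 := comm_of_mem_V h.row₀
  have h3 := comm_of_mem_V' h.col₀
  have hd := h.det_eq
  rcases h.entries 0 0 with h0 | ⟨u, -, hu⟩
  · rw [h0, zero_mul, zero_sub] at hd
    rcases h.entries 0 1 with hb | ⟨w, -, hw⟩
    · have : Subsingleton (Cliff n) := by
        refine subsingleton_of_zero_eq_one ?_
        rw [← hd, hb]; simp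
      exact Subsingleton.elim _ _
    · have e : (w : Cliff n) * -rev (M 1 0) = 1 := by rw [hw, mul_neg, hd]
      have e2 : -rev (M 1 0) * (w : Cliff n) = 1 := by
        rw [← Units.inv_eq_of_mul_eq_one_right e, Units.inv_mul]
      rw [h0, ← hw, mul_zero, zero_sub]
      simpa using congrArg rev e2
  · have key : M 0 0 * (rev (M 1 1) * M 0 0 - rev (M 0 1) * M 1 0) = M 0 0 := by
      calc M 0 0 * (rev (M 1 1) * M 0 0 - rev (M 0 1) * M 1 0)
          = M 0 0 * rev (M 1 1) * M 0 0 - (M 0 0 * rev (M 0 1)) * M 1 0 := by noncomm_ring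
        _ = M 0 0 * rev (M 1 1) * M 0 0 - M 0 1 * (rev (M 0 0) * M 1 0) := by
            rw [← h1]; noncomm_ring
        _ = (M 0 0 * rev (M 1 1) - M 0 1 * rev (M 1 0)) * M 0 0 := by
            rw [h3]; noncomm_ring
        _ = M 0 0 := by rw [hd, one_mul]
    rw [← hu] at key ⊢
    simpa using congrArg (fun x => ((u⁻¹ : (Cliff n)ˣ) : Cliff n) * x) key

theorem adj_mul (h : IsSLPlus M) : adj M * M = 1 := by
  have h1 := comm_of_mem_V' h.col₀
  have h2 := comm_of_mem_V' h.col₁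
  have h3 := h.adj_mul_det
  have h4 := congrArg rev h3
  simp only [rev_sub, rev_mul, rev_rev, rev_one] at h4
  ext i j
  fin_cases i <;> fin_cases j <;>
    simp [adj, Matrix.mul_apply, Fin.sum_univ_two, h1, h2]
  · rw [← sub_eq_add_neg]; exact h3
  · rw [neg_add_eq_sub]; exact h4

/-- Matrices satisfying the conditions are invertible, so that nothing is lost by defining the
group inside the group of invertible matrices. -/
theorem isUnit (h : IsSLPlus M) : IsUnit M := ⟨⟨M, adj M, h.mul_adj, h.adj_mul⟩, rfl⟩

theorem isSLPlus_adj (h : IsSLPlus M) : IsSLPlus (adj M) where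
  entries := by
    intro i j
    have h' := fun i j => rev_mem_Gam0 (h.entries i j)
    fin_cases i <;> fin_cases j
    exacts [h' 1 1, neg_mem_Gam0 (h' 0 1), neg_mem_Gam0 (h' 1 0), h' 0 0]
  det_eq := by simpa [adj] using h.adj_mul_det
  row₀ := by simpa [adj] using h.col₁
  row₁ := by simpa [adj] using h.col₀
  col₀ := by simpa [adj] using h.row₁
  col₁ := by simpa [adj] using h.row₀

theorem one : IsSLPlus (1 : Matrix (Fin 2) (Fin 2) (Cliff n)) where
  entries := by
    intro i j
    fin_cases i <;> fin_cases j <;> simp [one_mem_Gam0, zero_mem_Gam0]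
  det_eq := by simp
  row₀ := by simp
  row₁ := by simp
  col₀ := by simp
  col₁ := by simp

/-- The transpose of the entrywise reversed matrix. -/
noncomputable def tr (M : Matrix (Fin 2) (Fin 2) (Cliff n)) : Matrix (Fin 2) (Fin 2) (Cliff n) :=
  !![rev (M 0 0), rev (M 1 0); rev (M 0 1), rev (M 1 1)]

theorem isSLPlus_tr (h : IsSLPlus M) : IsSLPlus (tr M) where
  entries := by
    intro i j
    have h' := fun i j => rev_mem_Gam0 (h.entries i j)
    fin_cases i <;> fin_cases j
    exacts [h' 0 0, h' 1 0, h' 0 1, h' 1 1]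
  det_eq := by
    have := congrArg rev h.adj_mul_det
    simpa [tr] using this
  row₀ := by
    have := h.col₀
    rw [← comm_of_mem_V' this] at this
    simpa [tr] using this
  row₁ := by
    have := h.col₁
    rw [← comm_of_mem_V' this] at this
    simpa [tr] using this
  col₀ := by
    have := h.row₀
    rw [← comm_of_mem_V this] at this
    simpa [tr] using this
  col₁ := by
    have := h.row₁
    rw [← comm_of_mem_V this] at this
    simpa [tr] using this

theorem tr_mul : tr (M * N) = tr N * tr M := by
  ext i j
  fin_cases i <;> fin_cases j <;> simp [tr, Matrix.mul_apply, Fin.sum_univ_two]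

theorem row_mul (hM : IsSLPlus M) (hN : IsSLPlus N) (i : Fin 2) :
    (M * N) i 0 * rev ((M * N) i 1) ∈ V n := by
  have hrow : M i 0 * rev (M i 1) ∈ V n := by
    fin_cases i
    exacts [hM.row₀, hM.row₁]
  simp only [Matrix.mul_apply, Fin.sum_univ_two]
  exact row_mem_V (hM.entries _ _) (hM.entries _ _) (hN.entries _ _) hrow hN.det_eq
    hN.row₀ hN.row₁ hN.col₀

theorem mul (hM : IsSLPlus M) (hN : IsSLPlus N) : IsSLPlus (M * N) where
  entries := by
    intro i j
    have hrow : M i 0 * rev (M i 1) ∈ V n := by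
      fin_cases i
      exacts [hM.row₀, hM.row₁]
    have hcol : rev (N 1 j) * N 0 j ∈ V n := by
      fin_cases j
      exacts [hN.col₀, hN.col₁]
    rw [Matrix.mul_apply, Fin.sum_univ_two]
    exact add_mem_Gam0 (hM.entries _ _) (hM.entries _ _) (hN.entries _ _) (hN.entries _ _)
      hrow hcol
  det_eq := by
    have h1 := comm_of_mem_V hN.row₀
    have h2 := comm_of_mem_V hN.row₁
    have h3 := hN.det_eq
    have h4 := congrArg rev h3
    simp only [rev_sub, rev_mul, rev_rev, rev_one] at h4
    simp only [Matrix.mul_apply, Fin.sum_univ_two, rev_add, rev_mul]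
    calc _ = M 0 0 * (N 0 0 * rev (N 0 1) - N 0 1 * rev (N 0 0)) * rev (M 1 0) +
          M 0 1 * (N 1 0 * rev (N 1 1) - N 1 1 * rev (N 1 0)) * rev (M 1 1) +
          M 0 0 * (N 0 0 * rev (N 1 1) - N 0 1 * rev (N 1 0)) * rev (M 1 1) -
          M 0 1 * (N 1 1 * rev (N 0 0) - N 1 0 * rev (N 0 1)) * rev (M 1 0) := by noncomm_ring
      _ = 1 := by
        rw [h1, h2, h3, h4]
        simp only [sub_self, mul_zero, zero_mul, mul_one, add_zero, zero_add]
        exact hM.det_eq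
  row₀ := hM.row_mul hN 0
  row₁ := hM.row_mul hN 1
  col₀ := by
    have := hN.isSLPlus_tr.row_mul hM.isSLPlus_tr 0
    rw [← tr_mul, ← comm_of_mem_V this] at this
    simpa [tr] using this
  col₁ := by
    have := hN.isSLPlus_tr.row_mul hM.isSLPlus_tr 1
    rw [← tr_mul, ← comm_of_mem_V this] at this
    simpa [tr] using this

theorem inv_val {u : (Matrix (Fin 2) (Fin 2) (Cliff n))ˣ}
    (h : IsSLPlus (u : Matrix (Fin 2) (Fin 2) (Cliff n))) :
    ((u⁻¹ : (Matrix (Fin 2) (Fin 2) (Cliff n))ˣ) : Matrix (Fin 2) (Fin 2) (Cliff n)) =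
      adj (u : Matrix (Fin 2) (Fin 2) (Cliff n)) :=
  Units.inv_eq_of_mul_eq_one_right h.mul_adj

end IsSLPlus

/-- The group `SL₊(Γₙ(ℝ))`. -/
noncomputable def SLPlusReal (n : ℕ) : Subgroup (Matrix (Fin 2) (Fin 2) (Cliff n))ˣ where
  carrier := {u | IsSLPlus (u : Matrix (Fin 2) (Fin 2) (Cliff n))}
  mul_mem' ha hb := ha.mul hb
  one_mem' := IsSLPlus.one
  inv_mem' {u} hu := by
    change IsSLPlus _ at hu
    change IsSLPlus _
    rw [hu.inv_val]
    exact hu.isSLPlus_adj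

/-- The higher modular group `SL₊(Γₙ(ℤ))`: the matrices of `SL₊(Γₙ(ℝ))` all of whose entries lie
in `Γₙ(ℤ) ∪ {0}`, where `Γₙ(ℤ) = 𝒞ₙ(ℤ) ∩ Γₙ(ℝ)`. -/
noncomputable def SLPlusInt (n : ℕ) : Subgroup (Matrix (Fin 2) (Fin 2) (Cliff n))ˣ where
  carrier := {u | u ∈ SLPlusReal n ∧
    ∀ i j, (u : Matrix (Fin 2) (Fin 2) (Cliff n)) i j ∈ (integral n : Set (Cliff n)) ∩ Gam0 n}
  mul_mem' := by
    intro u w hu hw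
    have h := mul_mem hu.1 hw.1
    refine ⟨h, fun i j => ⟨?_, h.entries i j⟩⟩
    rw [Units.val_mul, Matrix.mul_apply]
    exact sum_mem fun k _ => mul_mem (hu.2 i k).1 (hw.2 k j).1
  one_mem' := by
    refine ⟨one_mem _, fun i j => ⟨?_, IsSLPlus.one.entries i j⟩⟩
    fin_cases i <;> fin_cases j <;> simp
  inv_mem' := by
    intro u hu
    have h := inv_mem hu.1
    refine ⟨h, fun i j => ⟨?_, h.entries i j⟩⟩
    rw [IsSLPlus.inv_val hu.1]
    have h' := fun i j => rev_mem_integral (hu.2 i j).1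
    fin_cases i <;> fin_cases j
    exacts [h' 1 1, neg_mem (h' 0 1), neg_mem (h' 1 0), h' 0 0]

/-! ### The inclusions `SL₊(Γₘ(ℤ)) → SL₊(Γₙ(ℤ))` for `m ≤ n` -/

/-- Extension by zero `ℝ^{m-1} → ℝ^{n-1}`, as an isometry of the quadratic forms. -/
noncomputable def formIncl {m n : ℕ} (h : m ≤ n) :
    cliffordForm m →qᵢ cliffordForm n where
  toFun v j := if hj : (j : ℕ) < m - 1 then v ⟨j, hj⟩ else 0
  map_add' v w := by ext j; by_cases hj : (j : ℕ) < m - 1 <;> simp [hj]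
  map_smul' c v := by ext j; by_cases hj : (j : ℕ) < m - 1 <;> simp [hj]
  map_app' v := by
    simp only [cliffordForm, QuadraticMap.weightedSumSquares_apply]
    symm
    refine Finset.sum_of_injOn (Fin.castLE (Nat.sub_le_sub_right h 1))
      (Fin.castLE_injective _).injOn (by simp) ?_ ?_
    · intro j _ hj
      have : ¬ (j : ℕ) < m - 1 := fun hlt => hj ⟨⟨j, hlt⟩, by simp, by ext; simp⟩
      simp [this]
    · intro j _
      simp

/-- The inclusion `𝒞ₘ(ℝ) → 𝒞ₙ(ℝ)`, sending `i_h` to `i_h` for `1 ≤ h ≤ m - 1`. -/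
noncomputable def cliffIncl {m n : ℕ} (h : m ≤ n) : Cliff m →ₐ[ℝ] Cliff n :=
  CliffordAlgebra.map (formIncl h)

section inclusion

variable {m n : ℕ} (h : m ≤ n)

theorem cliffIncl_gen (k : Fin (m - 1)) :
    cliffIncl h (gen m k) = gen n (Fin.castLE (Nat.sub_le_sub_right h 1) k) := by
  simp only [cliffIncl, gen, CliffordAlgebra.map_apply_ι]
  congr 1
  ext j
  change (if hj : (j : ℕ) < m - 1 then (Pi.single k (1 : ℝ) : Fin (m - 1) → ℝ) ⟨j, hj⟩ else 0) = _
  by_cases hj : (j : ℕ) < m - 1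
  · simp [hj, Pi.single_apply, Fin.ext_iff]
  · have : (j : ℕ) ≠ k := fun e => hj (e ▸ k.2)
    simp [hj, Fin.ext_iff, this]

theorem cliffIncl_rev (a : Cliff m) : cliffIncl h (rev a) = rev (cliffIncl h a) := by
  induction a using CliffordAlgebra.induction with
  | algebraMap r => simp [rev]
  | ι v => simp [rev, cliffIncl]
  | mul a b ha hb => simp [ha, hb]
  | add a b ha hb => simp [ha, hb]

theorem cliffIncl_mem_V {x : Cliff m} (hx : x ∈ V m) : cliffIncl h x ∈ V n := by
  obtain ⟨r, v, rfl⟩ := mem_V.1 hx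
  exact mem_V.2 ⟨r, formIncl h v, by simp [cliffIncl]⟩

theorem cliffIncl_mem_Gam0 {x : Cliff m} (hx : x ∈ Gam0 m) : cliffIncl h x ∈ Gam0 n := by
  rcases hx with rfl | ⟨u, hu, rfl⟩
  · rw [map_zero]; exact zero_mem_Gam0
  refine Or.inr ⟨Units.map (cliffIncl h : Cliff m →* Cliff n) u, ?_, rfl⟩
  induction hu using Subgroup.closure_induction with
  | mem u hu => exact Subgroup.subset_closure (cliffIncl_mem_V h hu)
  | one => rw [map_one]; exact one_mem _
  | mul u w _ _ hu hw => rw [map_mul]; exact mul_mem hu hw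
  | inv u _ hu => rw [map_inv]; exact inv_mem hu

theorem cliffIncl_mem_integral {x : Cliff m} (hx : x ∈ integral m) :
    cliffIncl h x ∈ integral n := by
  induction hx using Subring.closure_induction with
  | mem x hx =>
    obtain ⟨k, rfl⟩ := hx
    rw [cliffIncl_gen]
    exact Subring.subset_closure ⟨_, rfl⟩
  | zero => rw [map_zero]; exact zero_mem _
  | one => rw [map_one]; exact one_mem _
  | add x y _ _ hx hy => rw [map_add]; exact add_mem hx hy
  | neg x _ hx => rw [map_neg]; exact neg_mem hx
  | mul x y _ _ hx hy => rw [map_mul]; exact mul_mem hx hy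

/-- Apply `𝒞ₘ(ℝ) → 𝒞ₙ(ℝ)` to every entry of an invertible matrix. -/
noncomputable def matIncl :
    (Matrix (Fin 2) (Fin 2) (Cliff m))ˣ →* (Matrix (Fin 2) (Fin 2) (Cliff n))ˣ :=
  Units.map (MonoidHomClass.toMonoidHom (cliffIncl h).mapMatrix)

theorem matIncl_apply (u : (Matrix (Fin 2) (Fin 2) (Cliff m))ˣ) (i j : Fin 2) :
    (matIncl h u : Matrix (Fin 2) (Fin 2) (Cliff n)) i j =
      cliffIncl h ((u : Matrix (Fin 2) (Fin 2) (Cliff m)) i j) := rfl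

theorem matIncl_mem {u : (Matrix (Fin 2) (Fin 2) (Cliff m))ˣ} (hu : u ∈ SLPlusInt m) :
    matIncl h u ∈ SLPlusInt n := by
  have hu1 : IsSLPlus (u : Matrix (Fin 2) (Fin 2) (Cliff m)) := hu.1
  refine ⟨⟨fun i j => ?_, ?_, ?_, ?_, ?_, ?_⟩, fun i j => ?_⟩ <;>
    simp only [matIncl_apply, ← cliffIncl_rev, ← map_mul, ← map_sub]
  · exact cliffIncl_mem_Gam0 h (hu1.entries i j)
  · rw [hu1.det_eq, map_one]
  · exact cliffIncl_mem_V h hu1.row₀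
  · exact cliffIncl_mem_V h hu1.row₁
  · exact cliffIncl_mem_V h hu1.col₀
  · exact cliffIncl_mem_V h hu1.col₁
  · exact ⟨cliffIncl_mem_integral h (hu.2 i j).1, cliffIncl_mem_Gam0 h (hu1.entries i j)⟩

/-- The inclusion `SL₊(Γₘ(ℤ)) → SL₊(Γₙ(ℤ))` for `m ≤ n`. -/
noncomputable def SLPlusInt.incl : SLPlusInt m →* SLPlusInt n :=
  ((matIncl h).comp (SLPlusInt m).subtype).codRestrict (SLPlusInt n)
    fun u => matIncl_mem h u.2

end inclusion

/-! ### Free products with amalgamation -/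

section amalgam

variable {G₁ G₂ H : Type*} [Group G₁] [Group G₂] [Group H]

/-- The normal subgroup of `G₁ ∗ G₂` generated by the elements `f₁(h) f₂(h)⁻¹`, `h ∈ H`. -/
def amalgamRel (f₁ : H →* G₁) (f₂ : H →* G₂) : Subgroup (Monoid.Coprod G₁ G₂) :=
  Subgroup.normalClosure
    (Set.range fun h : H => Monoid.Coprod.inl (f₁ h) * (Monoid.Coprod.inr (f₂ h))⁻¹)

instance amalgamRel_normal (f₁ : H →* G₁) (f₂ : H →* G₂) : (amalgamRel f₁ f₂).Normal :=
  Subgroup.normalClosure_normal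

/-- The free product with amalgamation `G₁ ∗_H G₂ = (G₁ ∗ G₂) / N`. -/
abbrev AmalgamatedProduct (f₁ : H →* G₁) (f₂ : H →* G₂) : Type _ :=
  Monoid.Coprod G₁ G₂ ⧸ amalgamRel f₁ f₂

/-- The group `G` is a non-trivial free product with amalgamation `G₁ ∗_H G₂`: the maps
`f₁ : H → G₁` and `f₂ : H → G₂` are injective, neither of them is surjective, and
`G₁ ∗_H G₂ ≅ G`. The amalgamated subgroup `H` sits in `G` through the given homomorphism `e`. -/
def IsNontrivialAmalgam {H G : Type} [Group H] [Group G] (e : H →* G) : Prop :=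
  ∃ (G₁ G₂ : Type) (_ : Group G₁) (_ : Group G₂) (f₁ : H →* G₁) (f₂ : H →* G₂),
    Function.Injective f₁ ∧ Function.Injective f₂ ∧
    ¬ Function.Surjective f₁ ∧ ¬ Function.Surjective f₂ ∧
    ∃ φ : AmalgamatedProduct f₁ f₂ ≃* G,
      ∀ h : H, φ (QuotientGroup.mk (Monoid.Coprod.inl (f₁ h))) = e h

end amalgam

/-! The group `G` = SL₊(Γₙ(ℤ)) acts by m ↦ M m Mᴴ on the Hermitian matrices `herm x v y`, with `x`,
`y` real and `v` a vector, and preserves the form xy − |v|² of signature (1, n+1). This is its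
action on hyperbolic space of dimension n+1. Let `e` be the last generator if n ≥ 2 and 1 if n = 1.
The wall of `e` is the hyperplane orthogonal to the root `herm 0 e 0`; the base point is `herm 2 e
2`.

Everything rests on a parity. 𝒞ₙ(ℤ) is commutative modulo 2, and `star` and `rev` are trivial there.
So each translate of the root is `herm (2X) v (2Y)` with v ≡ e modulo 2 (`exists_root`), and any two
translates pair to an odd integer. The pairing has absolute value at least 1, so distinct walls do
not cross (`nested`). Pairings with the base point are odd too, so its orbit avoids all walls
(`height_ne_zero`). Finitely many walls separate two points of the orbit (`finite_separating`), and
only the wall of `e` separates the base point from its mirror image `herm 2 (-e) 2` (`act_eq_self`).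

Hence the walls are dual to a tree. `G` is transitive on its edges, and some `τ` inverts an edge, so
`G` is the amalgam of a vertex stabiliser and an unoriented edge stabiliser over the stabiliser of
the root. This is proved directly for half-spaces viewed as subsets of `G`: generation by counting
separating half-spaces (`IsNestedCut.mem_sup`), injectivity by ping-pong
(`AmalgamatedProduct.lift_injective`).

It remains to find the stabiliser of the root. `M` fixes the root if and only if each entry `x`
satisfies x e = e x′ with x′ the main involution of `x`, that is, `x` does not involve `e`
(`mem_range_incl_iff`). For such an `M` to lie in the smaller modular group its entries must lie in
Γₙ₋₁(ℝ) ∪ {0}. This is automatic when 𝒞ₙ₋₁(ℝ) is ℝ, ℂ or the quaternions (`mem_Gam0_of_le_three`),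
whence n ≤ 4. For n = 1 only ±I fix the root. -/

open scoped Pointwise

/-! ### A criterion for a group to be an amalgamated product -/

section pingpong

variable {G₁ G₂ H G : Type*} [Group G₁] [Group G₂] [Group H] [Group G]

/-- The elements of `G₁ ∗_H G₂` that are alternating products of elements of `G₁` and `G₂` outside
`H`; the index is `true` if the leftmost factor lies in `G₁`. -/
inductive IsReducedElement (f₁ : H →* G₁) (f₂ : H →* G₂) :
    Bool → AmalgamatedProduct f₁ f₂ → Prop
  | left (g : G₁) (hg : g ∉ f₁.range) :
      IsReducedElement f₁ f₂ true (QuotientGroup.mk (Monoid.Coprod.inl g))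
  | right (g : G₂) (hg : g ∉ f₂.range) :
      IsReducedElement f₁ f₂ false (QuotientGroup.mk (Monoid.Coprod.inr g))
  | left_mul (g : G₁) (hg : g ∉ f₁.range) (x : AmalgamatedProduct f₁ f₂) :
      IsReducedElement f₁ f₂ false x →
        IsReducedElement f₁ f₂ true (QuotientGroup.mk (Monoid.Coprod.inl g) * x)
  | right_mul (g : G₂) (hg : g ∉ f₂.range) (x : AmalgamatedProduct f₁ f₂) :
      IsReducedElement f₁ f₂ true x →
        IsReducedElement f₁ f₂ false (QuotientGroup.mk (Monoid.Coprod.inr g) * x)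

namespace AmalgamatedProduct

variable (f₁ : H →* G₁) (f₂ : H →* G₂)

/-- The canonical map `G₁ → G₁ ∗_H G₂`. -/
def inl : G₁ →* AmalgamatedProduct f₁ f₂ := (QuotientGroup.mk' _).comp Monoid.Coprod.inl

/-- The canonical map `G₂ → G₁ ∗_H G₂`. -/
def inr : G₂ →* AmalgamatedProduct f₁ f₂ := (QuotientGroup.mk' _).comp Monoid.Coprod.inr

theorem inl_eq_inr (h : H) : inl f₁ f₂ (f₁ h) = inr f₁ f₂ (f₂ h) := by
  have : Monoid.Coprod.inl (f₁ h) * (Monoid.Coprod.inr (f₂ h))⁻¹ ∈ amalgamRel f₁ f₂ :=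
    Subgroup.subset_normalClosure ⟨h, rfl⟩
  have h1 := (QuotientGroup.eq_one_iff _).2 this
  rw [QuotientGroup.mk_mul, QuotientGroup.mk_inv, mul_inv_eq_one] at h1
  exact h1

variable {f₁ f₂}

theorem induction_on {p : AmalgamatedProduct f₁ f₂ → Prop} (x : AmalgamatedProduct f₁ f₂)
    (one : p 1) (inl_mul : ∀ g x, p x → p (inl f₁ f₂ g * x))
    (inr_mul : ∀ g x, p x → p (inr f₁ f₂ g * x)) : p x := by
  obtain ⟨y, rfl⟩ := QuotientGroup.mk_surjective x
  induction y using Monoid.Coprod.induction_on' with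
  | one => exact one
  | inl_mul g y h => exact inl_mul g _ h
  | inr_mul g y h => exact inr_mul g _ h

theorem isReducedElement_inl_mul {g : G₁} (hg : g ∉ f₁.range) {x : AmalgamatedProduct f₁ f₂}
    (hx : IsReducedElement f₁ f₂ false x) : IsReducedElement f₁ f₂ true (inl f₁ f₂ g * x) :=
  .left_mul g hg x hx

theorem isReducedElement_inr_mul {g : G₂} (hg : g ∉ f₂.range) {x : AmalgamatedProduct f₁ f₂}
    (hx : IsReducedElement f₁ f₂ true x) : IsReducedElement f₁ f₂ false (inr f₁ f₂ g * x) :=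
  .right_mul g hg x hx

/-- The leftmost letter absorbs `h` and stays outside `H`. -/
theorem isReducedElement_map_mul (h : H) {b : Bool} {x : AmalgamatedProduct f₁ f₂}
    (hx : IsReducedElement f₁ f₂ b x) : IsReducedElement f₁ f₂ b (inl f₁ f₂ (f₁ h) * x) := by
  have h₁ : ∀ g ∉ f₁.range, f₁ h * g ∉ f₁.range := fun g hg hh =>
    hg ((Subgroup.mul_mem_cancel_left _ (MonoidHom.mem_range.2 ⟨h, rfl⟩)).1 hh)
  have h₂ : ∀ g ∉ f₂.range, f₂ h * g ∉ f₂.range := fun g hg hh =>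
    hg ((Subgroup.mul_mem_cancel_left _ (MonoidHom.mem_range.2 ⟨h, rfl⟩)).1 hh)
  cases hx with
  | left g hg =>
    change IsReducedElement f₁ f₂ true (inl f₁ f₂ (f₁ h) * inl f₁ f₂ g)
    rw [← map_mul]
    exact .left _ (h₁ g hg)
  | right g hg =>
    change IsReducedElement f₁ f₂ false (inl f₁ f₂ (f₁ h) * inr f₁ f₂ g)
    rw [inl_eq_inr, ← map_mul]
    exact .right _ (h₂ g hg)
  | left_mul g hg x hx =>
    change IsReducedElement f₁ f₂ true (inl f₁ f₂ (f₁ h) * (inl f₁ f₂ g * x))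
    rw [← mul_assoc, ← map_mul]
    exact isReducedElement_inl_mul (h₁ g hg) hx
  | right_mul g hg x hx =>
    change IsReducedElement f₁ f₂ false (inl f₁ f₂ (f₁ h) * (inr f₁ f₂ g * x))
    rw [inl_eq_inr, ← mul_assoc, ← map_mul]
    exact isReducedElement_inr_mul (h₂ g hg) hx

/-- Two adjacent letters of the same factor merge; if their product falls into `H`, the next letter
absorbs it. Uniqueness of the form is not needed, so no coset representatives are chosen. -/
theorem eq_map_or_isReducedElement (x : AmalgamatedProduct f₁ f₂) :
    (∃ h, x = inl f₁ f₂ (f₁ h)) ∨ ∃ b, IsReducedElement f₁ f₂ b x := by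
  induction x using induction_on with
  | one => exact .inl ⟨1, by simp⟩
  | inl_mul g x hx =>
    by_cases hg : g ∈ f₁.range
    · obtain ⟨k, rfl⟩ := hg
      rcases hx with ⟨h, rfl⟩ | ⟨b, hx⟩
      · exact .inl ⟨k * h, by simp⟩
      · exact .inr ⟨b, isReducedElement_map_mul k hx⟩
    rcases hx with ⟨h, rfl⟩ | ⟨b, hx⟩
    · refine .inr ⟨true, ?_⟩
      rw [← map_mul]
      exact .left _ fun hh =>
          hg ((Subgroup.mul_mem_cancel_right _ (MonoidHom.mem_range.2 ⟨h, rfl⟩)).1 hh)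
    cases hx with
    | left g' hg' =>
      change _ ∨ ∃ b, IsReducedElement f₁ f₂ b (inl f₁ f₂ g * inl f₁ f₂ g')
      change (∃ h, inl f₁ f₂ g * inl f₁ f₂ g' = _) ∨ _
      rw [← map_mul]
      by_cases hh : g * g' ∈ f₁.range
      · obtain ⟨h, hh⟩ := hh
        exact .inl ⟨h, by rw [hh]⟩
      · exact .inr ⟨true, .left _ hh⟩
    | left_mul g' hg' x hx =>
      right
      change ∃ b, IsReducedElement f₁ f₂ b (inl f₁ f₂ g * (inl f₁ f₂ g' * x))
      rw [← mul_assoc, ← map_mul]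
      by_cases hh : g * g' ∈ f₁.range
      · obtain ⟨h, hh⟩ := hh
        rw [← hh]
        exact ⟨_, isReducedElement_map_mul h hx⟩
      · exact ⟨true, isReducedElement_inl_mul hh hx⟩
    | right g' hg' => exact .inr ⟨true, isReducedElement_inl_mul hg (.right g' hg')⟩
    | right_mul g' hg' x hx =>
      exact .inr ⟨true, isReducedElement_inl_mul hg (.right_mul g' hg' x hx)⟩
  | inr_mul g x hx =>
    by_cases hg : g ∈ f₂.range
    · obtain ⟨k, rfl⟩ := hg
      rw [← inl_eq_inr]
      rcases hx with ⟨h, rfl⟩ | ⟨b, hx⟩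
      · exact .inl ⟨k * h, by simp⟩
      · exact .inr ⟨b, isReducedElement_map_mul k hx⟩
    rcases hx with ⟨h, rfl⟩ | ⟨b, hx⟩
    · refine .inr ⟨false, ?_⟩
      rw [inl_eq_inr, ← map_mul]
      exact .right _ fun hh =>
          hg ((Subgroup.mul_mem_cancel_right _ (MonoidHom.mem_range.2 ⟨h, rfl⟩)).1 hh)
    cases hx with
    | right g' hg' =>
      change _ ∨ ∃ b, IsReducedElement f₁ f₂ b (inr f₁ f₂ g * inr f₁ f₂ g')
      change (∃ h, inr f₁ f₂ g * inr f₁ f₂ g' = _) ∨ _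
      rw [← map_mul]
      by_cases hh : g * g' ∈ f₂.range
      · obtain ⟨h, hh⟩ := hh
        exact .inl ⟨h, by rw [inl_eq_inr, hh]⟩
      · exact .inr ⟨false, .right _ hh⟩
    | right_mul g' hg' x hx =>
      right
      change ∃ b, IsReducedElement f₁ f₂ b (inr f₁ f₂ g * (inr f₁ f₂ g' * x))
      rw [← mul_assoc, ← map_mul]
      by_cases hh : g * g' ∈ f₂.range
      · obtain ⟨h, hh⟩ := hh
        rw [← hh, ← inl_eq_inr]
        exact ⟨_, isReducedElement_map_mul h hx⟩
      · exact ⟨false, isReducedElement_inr_mul hh hx⟩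
    | left g' hg' => exact .inr ⟨false, isReducedElement_inr_mul hg (.left g' hg')⟩
    | left_mul g' hg' x hx =>
      exact .inr ⟨false, isReducedElement_inr_mul hg (.left_mul g' hg' x hx)⟩

/-- The map out of `G₁ ∗_H G₂` given by two maps that agree on `H`. -/
def lift (φ₁ : G₁ →* G) (φ₂ : G₂ →* G) (h : ∀ x, φ₁ (f₁ x) = φ₂ (f₂ x)) :
    AmalgamatedProduct f₁ f₂ →* G :=
  QuotientGroup.lift _ (Monoid.Coprod.lift φ₁ φ₂) <| by
    have : amalgamRel f₁ f₂ ≤ (Monoid.Coprod.lift φ₁ φ₂).ker := by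
      refine Subgroup.normalClosure_le_normal ?_
      rintro _ ⟨x, rfl⟩
      simp [MonoidHom.mem_ker, h]
    exact this

@[simp] theorem lift_inl (φ₁ : G₁ →* G) (φ₂ : G₂ →* G) (h : ∀ x, φ₁ (f₁ x) = φ₂ (f₂ x)) (g : G₁) :
    lift φ₁ φ₂ h (inl f₁ f₂ g) = φ₁ g := by
  simp [lift, inl]

@[simp] theorem lift_inr (φ₁ : G₁ →* G) (φ₂ : G₂ →* G) (h : ∀ x, φ₁ (f₁ x) = φ₂ (f₂ x)) (g : G₂) :
    lift φ₁ φ₂ h (inr f₁ f₂ g) = φ₂ g := by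
  simp [lift, inr]

/-- Ping-pong for amalgamated products. -/
theorem lift_injective (φ₁ : G₁ →* G) (φ₂ : G₂ →* G) (h : ∀ x, φ₁ (f₁ x) = φ₂ (f₂ x))
    (hinj : Function.Injective (φ₁.comp f₁)) (p : Bool → G → Prop) (hp : ∀ b, ¬ p b 1)
    (left : ∀ g ∉ f₁.range, p true (φ₁ g)) (right : ∀ g ∉ f₂.range, p false (φ₂ g))
    (left_mul : ∀ g ∉ f₁.range, ∀ x, p false x → p true (φ₁ g * x))
    (right_mul : ∀ g ∉ f₂.range, ∀ x, p true x → p false (φ₂ g * x)) :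
    Function.Injective (lift φ₁ φ₂ h) := by
  have key : ∀ b x, IsReducedElement f₁ f₂ b x → p b (lift φ₁ φ₂ h x) := by
    intro b x hx
    induction hx with
    | left g hg => exact (lift_inl φ₁ φ₂ h g).symm ▸ left g hg
    | right g hg => exact (lift_inr φ₁ φ₂ h g).symm ▸ right g hg
    | left_mul g hg x hx ih =>
      have := left_mul g hg _ ih
      rwa [← lift_inl φ₁ φ₂ h g, ← map_mul] at this
    | right_mul g hg x hx ih =>
      have := right_mul g hg _ ih
      rwa [← lift_inr φ₁ φ₂ h g, ← map_mul] at this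
  rw [injective_iff_map_eq_one]
  intro x hx
  -- A kernel element in `H` is trivial by `hinj`; a reduced word has an image satisfying some `p
  -- b`, which 1 does not.
  rcases eq_map_or_isReducedElement x with ⟨k, rfl⟩ | ⟨b, hb⟩
  · rw [lift_inl] at hx
    rw [(injective_iff_map_eq_one _).1 hinj k hx, map_one, map_one]
  · exact absurd (hx ▸ key b x hb) (hp b)

end AmalgamatedProduct

end pingpong

/-! ### Splitting a group along a nested cut -/

section cut

variable {G : Type*} [Group G]

/-- A subset `A` of a group whose translates are pairwise nested, in the sense of actions on
trees: the translates of `A` are the half-spaces of a tree on which the group acts with one orbit of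
vertices and with inversions. -/
structure IsNestedCut (A : Set G) (τ : G) : Prop where
  one_mem : 1 ∈ A
  flip : τ • A = Aᶜ
  nested : ∀ k : G, k • A ⊆ A ∨ A ⊆ k • A ∨ Disjoint (k • A) A ∨ (k • A)ᶜ ⊆ A
  minimal : ∀ k : G, 1 ∈ k • A → k • A ⊆ A → k • A = A
  finite : ∀ g : G, {B : Set G | (∃ k : G, k • A = B) ∧ 1 ∈ B ∧ g ∉ B}.Finite

/-- The stabiliser of the vertex given by the half-spaces that contain `1`. -/
def cutVertexGroup (A : Set G) : Subgroup G where
  carrier := {g | ∀ k : G, g ∈ k • A ↔ 1 ∈ k • A}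
  one_mem' _ := Iff.rfl
  mul_mem' {g h} hg hh k := by
    rw [← hg k]
    have := hh (g⁻¹ * k)
    simpa [Set.mem_smul_set_iff_inv_smul_mem, mul_assoc] using this
  inv_mem' {g} hg k := by
    have := hg (g * k)
    simpa [Set.mem_smul_set_iff_inv_smul_mem, mul_assoc] using this.symm

/-- The stabiliser of an edge, including the inversions. -/
def cutEdgeGroup (A : Set G) : Subgroup G where
  carrier := {g | g • A = A ∨ g • A = Aᶜ}
  one_mem' := .inl (one_smul _ _)
  mul_mem' {g h} hg hh := by
    rcases hg with hg | hg <;> rcases hh with hh | hh <;>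
      simp [mul_smul, hg, hh, Set.smul_set_compl]
  inv_mem' {g} hg := by
    rcases hg with hg | hg
    · exact .inl (inv_smul_eq_iff.2 hg.symm)
    · refine .inr (inv_smul_eq_iff.2 ?_)
      rw [Set.smul_set_compl, hg, compl_compl]

namespace IsNestedCut

variable {A : Set G} {τ : G} (hA : IsNestedCut A τ)
include hA

theorem compl_smul (k : G) : (k • A)ᶜ = (k * τ) • A := by
  rw [mul_smul, hA.flip, Set.smul_set_compl]

/-- The complement of a translate is again a translate, so one implication for all `k` yields the
converse. -/
theorem mem_cutVertexGroup_of_forall {g : G} (h : ∀ k : G, 1 ∈ k • A → g ∈ k • A) :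
    g ∈ cutVertexGroup A := by
  intro k
  refine ⟨fun hg => by_contra fun h1 => ?_, h k⟩
  have := h (k * τ) (by rw [← hA.compl_smul]; exact h1)
  rw [← hA.compl_smul] at this
  exact this hg

/-- In the tree, a minimal half-space around the base vertex is bounded by an edge at that vertex,
so `k` fixes the vertex. If `j • A` contained 1 but not `k`, each of its four positions relative to
`k • A` would contradict minimality of `k • A`, minimality of `A`, or the location of 1 and `k`. -/
theorem mem_cutVertexGroup_of_minimal {k : G} (h1 : 1 ∈ k • A)
    (hk : ∀ j : G, 1 ∈ j • A → j • A ⊆ k • A → j • A = k • A) : k ∈ cutVertexGroup A := by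
  refine hA.mem_cutVertexGroup_of_forall fun j hj => by_contra fun hkj => ?_
  have hkk : k ∈ k • A := by
    rw [Set.mem_smul_set_iff_inv_smul_mem]; simpa using hA.one_mem
  rcases hA.nested (k⁻¹ * j) with h | h | h | h
  · rw [mul_smul, Set.smul_set_subset_iff_subset_inv_smul_set, inv_inv] at h
    rw [hk j hj h] at hkj
    exact hkj hkk
  · rw [mul_smul, Set.subset_smul_set_iff, inv_inv] at h
    exact hkj (h hkk)
  · rw [Set.disjoint_left] at h
    refine @h k⁻¹ ?_ ?_
    · simpa [Set.mem_smul_set_iff_inv_smul_mem] using hj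
    · simpa [Set.mem_smul_set_iff_inv_smul_mem] using h1
  · rw [hA.compl_smul] at h
    have h2 := hA.minimal (k⁻¹ * j * τ) (by
      rw [← hA.compl_smul]
      simpa [Set.mem_smul_set_iff_inv_smul_mem] using hkj) h
    rw [← hA.compl_smul] at h2
    have h3 : k⁻¹ ∈ A := by simpa [Set.mem_smul_set_iff_inv_smul_mem] using h1
    rw [← h2] at h3
    exact h3 (by simpa [Set.mem_smul_set_iff_inv_smul_mem] using hj)

theorem mem_cutVertexGroup_of_smul_eq {k : G} (hk : k • A = A) : k ∈ cutVertexGroup A :=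
  hA.mem_cutVertexGroup_of_minimal (by rw [hk]; exact hA.one_mem) fun j hj hjk => by
    rw [hk] at hjk ⊢
    exact hA.minimal j hj hjk

theorem smul_ne_compl {g : G} (hg : g ∈ cutVertexGroup A) : g • A ≠ Aᶜ := by
  intro h
  have h1 := hg g
  rw [h] at h1
  exact h1.1 (by rw [← h, Set.mem_smul_set_iff_inv_smul_mem]; simpa using hA.one_mem) hA.one_mem

/-- An element of the vertex group that does not stabilise the edge maps the half-space behind the
edge strictly into the other one. -/
theorem smul_compl_ssubset {g : G} (hg : g ∈ cutVertexGroup A) (hg' : g • A ≠ A) :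
    g • Aᶜ ⊂ A := by
  have h1 : 1 ∈ g • A := (hg g).1 (by
    rw [Set.mem_smul_set_iff_inv_smul_mem]; simpa using hA.one_mem)
  have h2 : g ∈ A := by
    have := hg 1
    rw [one_smul] at this
    exact this.2 hA.one_mem
  refine lt_of_le_of_ne ?_ ?_
  · rcases hA.nested g with h | h | h | h
    · exact absurd (hA.minimal g h1 h) hg'
    · rw [Set.subset_smul_set_iff] at h
      have := hA.minimal g⁻¹ (by simpa [Set.mem_smul_set_iff_inv_smul_mem] using h2) h
      rw [inv_smul_eq_iff] at this
      exact absurd this.symm hg'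
    · exact absurd hA.one_mem (Set.disjoint_left.1 h h1)
    · rwa [Set.smul_set_compl]
  · intro h
    rw [Set.smul_set_compl, compl_eq_comm] at h
    exact hA.smul_ne_compl hg h.symm

/-- The edge of `A` joins the vertices of 1 and `τ`, and `g` lies beyond it. A half-space separating
`τ` from `g` therefore separates 1 from `g` as well. -/
theorem separating_flip {g : G} (hg : g ∉ A) {j : G} (hj : τ ∈ j • A) (hgj : g ∉ j • A) :
    1 ∈ j • A ∧ j • A ≠ A := by
  have hτ : τ ∉ A := by
    have : τ ∈ τ • A := by rw [Set.mem_smul_set_iff_inv_smul_mem]; simpa using hA.one_mem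
    rw [hA.flip] at this
    exact this
  refine ⟨by_contra fun h1 => ?_, fun h => hτ (h ▸ hj)⟩
  rcases hA.nested (j * τ) with h | h | h | h
  · have := hA.minimal (j * τ) (by rw [← hA.compl_smul]; exact h1) h
    rw [← hA.compl_smul] at this
    rw [← this] at hg
    exact hg hgj
  · rw [← hA.compl_smul] at h
    have hs : j • A ⊆ τ • A := by rw [hA.flip]; exact Set.subset_compl_comm.1 h
    have := hA.minimal (τ⁻¹ * j) (by
      simpa [Set.mem_smul_set_iff_inv_smul_mem] using hj) (by
      rwa [mul_smul, Set.smul_set_subset_iff_subset_inv_smul_set, inv_inv])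
    rw [mul_smul, inv_smul_eq_iff, hA.flip] at this
    rw [this] at hgj
    exact hgj hg
  · rw [← hA.compl_smul] at h
    exact Set.disjoint_left.1 h h1 hA.one_mem
  · rw [← hA.compl_smul, compl_compl] at h
    exact hτ (h hj)

/-- Walk from the base vertex towards its image under `g`, one edge at a time; the induction is on
the number of half-spaces that contain 1 but not `g`. -/
theorem mem_sup (g : G) : g ∈ cutVertexGroup A ⊔ cutEdgeGroup A := by
  set S : G → Set (Set G) := fun g => {B | (∃ k : G, k • A = B) ∧ 1 ∈ B ∧ g ∉ B} with hS
  obtain ⟨N, hN⟩ : ∃ N, (S g).ncard = N := ⟨_, rfl⟩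
  induction N using Nat.strong_induction_on generalizing g with
  | _ N ih =>
  by_cases hemp : S g = ∅
  · refine (le_sup_left : _ ≤ cutVertexGroup A ⊔ cutEdgeGroup A)
      (hA.mem_cutVertexGroup_of_forall fun k hk => by_contra fun hgk => ?_)
    have : k • A ∈ S g := ⟨⟨k, rfl⟩, hk, hgk⟩
    rw [hemp] at this
    exact this
  obtain ⟨B, hB⟩ := (hA.finite g).exists_minimal (Set.nonempty_iff_ne_empty.2 hemp)
  obtain ⟨⟨k, rfl⟩, hk1, hkg⟩ := hB.prop
  -- Minimality among the separating half-spaces is minimality among all half-spaces containing 1,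
  -- since a smaller one misses `g` too.
  have hk : k ∈ cutVertexGroup A := hA.mem_cutVertexGroup_of_minimal hk1 fun j hj hjk =>
    hB.eq_of_subset ⟨⟨j, rfl⟩, hj, fun h => hkg (hjk h)⟩ hjk
  have hkg' : k⁻¹ * g ∉ A := by
    simpa [Set.mem_smul_set_iff_inv_smul_mem] using hkg
  -- `k * τ` crosses the edge of `k • A`. What still separates after the crossing separated before,
  -- and `k • A` is lost, so the count drops.
  have hsub : (fun B => (k * τ) • B) '' S (τ⁻¹ * (k⁻¹ * g)) ⊆ S g \ {k • A} := by
    rintro _ ⟨_, ⟨⟨j, rfl⟩, h1, h2⟩, rfl⟩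
    obtain ⟨h3, h4⟩ := hA.separating_flip hkg' (j := τ * j)
      (by simpa [Set.mem_smul_set_iff_inv_smul_mem, mul_assoc] using h1)
      (by simpa [Set.mem_smul_set_iff_inv_smul_mem, mul_assoc] using h2)
    refine ⟨⟨⟨k * τ * j, mul_smul _ _ _⟩, ?_, ?_⟩, ?_⟩
    · simp only [← mul_smul]
      rw [← (hk (k * τ * j))]
      simpa [Set.mem_smul_set_iff_inv_smul_mem, mul_assoc] using h3
    · simpa [Set.mem_smul_set_iff_inv_smul_mem, mul_assoc] using h2
    · intro h
      simp only [Set.mem_singleton_iff, ← mul_smul, mul_assoc] at h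
      rw [mul_smul, smul_left_cancel_iff] at h
      exact h4 h
  have hlt : (S (τ⁻¹ * (k⁻¹ * g))).ncard < N := by
    rw [← Set.ncard_image_of_injective _ (MulAction.injective (k * τ)), ← hN]
    refine Set.ncard_lt_ncard (lt_of_le_of_lt hsub ?_) (hA.finite g)
    exact Set.sdiff_singleton_ssubset.2 hB.prop
  have h5 := ih _ hlt _ rfl
  have h6 : k * τ ∈ cutVertexGroup A ⊔ cutEdgeGroup A :=
    mul_mem ((le_sup_left : _ ≤ cutVertexGroup A ⊔ cutEdgeGroup A) hk)
      ((le_sup_right : _ ≤ cutVertexGroup A ⊔ cutEdgeGroup A) (.inr hA.flip))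
  simpa [mul_assoc] using mul_mem h6 h5

end IsNestedCut

open AmalgamatedProduct in
/-- A nested cut with stabiliser `H` gives a splitting of the group as an amalgamated product over
`H`. -/
theorem IsNestedCut.isNontrivialAmalgam {H G : Type} [Group H] [Group G] {A : Set G} {τ : G}
    (hA : IsNestedCut A τ) (e : H →* G) (he : Function.Injective e)
    (hrange : ∀ k : G, k ∈ e.range ↔ k • A = A)
    (hne : ∃ g ∈ cutVertexGroup A, g • A ≠ A) : IsNontrivialAmalgam e := by
  have hsm : ∀ h, e h • A = A := fun h => (hrange _).1 ⟨h, rfl⟩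
  let f₁ : H →* cutVertexGroup A :=
    e.codRestrict _ fun h => hA.mem_cutVertexGroup_of_smul_eq (hsm h)
  let f₂ : H →* cutEdgeGroup A := e.codRestrict _ fun h => .inl (hsm h)
  have hf₁ : ∀ g : cutVertexGroup A, g ∉ f₁.range → (g : G) • A ≠ A := by
    intro g hg h
    obtain ⟨x, hx⟩ := (hrange _).2 h
    exact hg ⟨x, Subtype.ext hx⟩
  have hf₂ : ∀ g : cutEdgeGroup A, g ∉ f₂.range → (g : G) • A = Aᶜ := by
    intro g hg
    refine g.2.resolve_left fun h => ?_
    obtain ⟨x, hx⟩ := (hrange _).2 h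
    exact hg ⟨x, Subtype.ext hx⟩
  have hτ : τ ∉ A := by
    have : τ ∈ τ • A := by rw [Set.mem_smul_set_iff_inv_smul_mem]; simpa using hA.one_mem
    rw [hA.flip] at this
    exact this
  have hnc : ¬ A = Aᶜ := fun h => by
    have := hA.one_mem
    rw [h] at this
    exact this hA.one_mem
  let φ := lift (f₁ := f₁) (f₂ := f₂) (cutVertexGroup A).subtype (cutEdgeGroup A).subtype
    fun _ => rfl
  have hφ : Function.Injective φ := by
    -- A word starting in the vertex group maps one side of the edge strictly into `A`, one starting
    -- in the edge group maps one side into `Aᶜ`; which side depends on the rightmost letter. A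
    -- single edge letter maps `A` onto `Aᶜ`, hence the extra equality.
    refine lift_injective _ _ _ (fun x y h => he h)
      (fun b x => if b then x • A ⊂ A ∨ x • Aᶜ ⊂ A else
        x • A ⊂ Aᶜ ∨ x • Aᶜ ⊂ Aᶜ ∨ x • A = Aᶜ) ?_ ?_ ?_ ?_ ?_
    · rintro (_ | _)
      · simp only [one_smul, Bool.false_eq_true, if_false]
        rintro (h | h | h)
        · exact h.subset hA.one_mem hA.one_mem
        · exact h.ne rfl
        · exact hnc h
      · simp only [one_smul, if_true]
        rintro (h | h)
        · exact h.ne rfl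
        · exact hτ (h.subset hτ)
    · intro g hg
      exact .inr (hA.smul_compl_ssubset g.2 (hf₁ g hg))
    · intro g hg
      exact .inr (.inr (hf₂ g hg))
    · intro g hg x hx
      have h1 := hA.smul_compl_ssubset g.2 (hf₁ g hg)
      have h2 : ∀ B : Set G, B ⊂ Aᶜ → (g : G) • B ⊂ A := fun B hB =>
        ((Set.smul_set_mono hB.subset).trans_ssubset h1)
      simp only [Bool.false_eq_true, if_false] at hx
      simp only [if_true, Subgroup.coe_subtype, mul_smul]
      rcases hx with hx | hx | hx
      · exact .inl (h2 _ hx)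
      · exact .inr (h2 _ hx)
      · rw [hx]; exact .inl h1
    · intro g hg x hx
      have h2 : ∀ B : Set G, B ⊂ A → (g : G) • B ⊂ Aᶜ := fun B hB => by
        rw [← hf₂ g hg]
        refine lt_of_le_of_ne (Set.smul_set_mono hB.subset) fun h => hB.ne ?_
        exact smul_left_cancel _ h
      simp only [if_true] at hx
      simp only [Bool.false_eq_true, if_false, Subgroup.coe_subtype, mul_smul]
      rcases hx with hx | hx
      · exact .inl (h2 _ hx)
      · exact .inr (.inl (h2 _ hx))
  have hφ' : Function.Surjective φ := by
    rw [← MonoidHom.range_eq_top, eq_top_iff]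
    intro g _
    have hle : cutVertexGroup A ⊔ cutEdgeGroup A ≤ φ.range := sup_le
      (fun g hg => ⟨inl f₁ f₂ ⟨g, hg⟩, lift_inl _ _ _ _⟩)
      (fun g hg => ⟨inr f₁ f₂ ⟨g, hg⟩, lift_inr _ _ _ _⟩)
    exact hle (hA.mem_sup g)
  refine ⟨cutVertexGroup A, cutEdgeGroup A, inferInstance, inferInstance, f₁, f₂, ?_, ?_, ?_, ?_,
    MulEquiv.ofBijective φ ⟨hφ, hφ'⟩, ?_⟩
  · exact fun x y h => he (congrArg Subtype.val h)
  · exact fun x y h => he (congrArg Subtype.val h)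
  · intro h
    obtain ⟨g, hg, hgA⟩ := hne
    obtain ⟨x, hx⟩ := h ⟨g, hg⟩
    exact hgA ((hrange g).1 ⟨x, congrArg Subtype.val hx⟩)
  · intro h
    obtain ⟨x, hx⟩ := h ⟨τ, .inr hA.flip⟩
    have := (hrange τ).1 ⟨x, congrArg Subtype.val hx⟩
    rw [hA.flip] at this
    exact hnc this.symm
  · intro h
    exact lift_inl (f₁ := f₁) (f₂ := f₂) (cutVertexGroup A).subtype (cutEdgeGroup A).subtype
      (fun _ => rfl) (f₁ h)

end cut

/-! ### The real part of an element of the Clifford algebra -/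

namespace Cliff

section repr

variable {m : ℕ}

/-- Flip the `j`-th entry of `S`. -/
def flipAt (j : Fin m) (S : Fin m → Bool) : Fin m → Bool := Function.update S j (!S j)

/-- The local factors of `reprSign`. -/
def reprFactor (j k : Fin m) (b : Bool) : ℤ :=
  if k < j then (if b then -1 else 1) else if k = j then (if b then 1 else -1) else 1

/-- The signs in the representation of the Clifford algebra by signed permutations. -/
def reprSign (j : Fin m) (S : Fin m → Bool) : ℤ := ∏ k, reprFactor j k (S k)

theorem reprSign_flipAt (j l : Fin m) (S : Fin m → Bool) :
    reprSign j (flipAt l S) = (if l ≤ j then -1 else 1) * reprSign j S := by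
  have h : ∀ k, reprFactor j k (flipAt l S k) =
      (if k = l then (if l ≤ j then -1 else 1) else 1) * reprFactor j k (S k) := by
    intro k
    by_cases hk : k = l
    · subst hk
      rcases lt_trichotomy k j with h | h | h
      · cases hS : S k <;> simp [flipAt, reprFactor, h, h.le, hS]
      · subst h; cases hS : S k <;> simp [flipAt, reprFactor, hS]
      · simp [reprFactor, h.not_gt, h.ne', h.not_ge]
    · simp [flipAt, hk]
  simp only [reprSign, h, Finset.prod_mul_distrib, Finset.prod_ite_eq', Finset.mem_univ, if_true]

theorem reprSign_mul_self (j : Fin m) (S : Fin m → Bool) : reprSign j S * reprSign j S = 1 := by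
  rw [reprSign, ← Finset.prod_mul_distrib]
  refine Finset.prod_eq_one fun k _ => ?_
  unfold reprFactor
  split_ifs <;> rfl

theorem flipAt_flipAt (j : Fin m) (S : Fin m → Bool) : flipAt j (flipAt j S) = S := by
  simp [flipAt]

theorem flipAt_comm (j l : Fin m) (S : Fin m → Bool) :
    flipAt j (flipAt l S) = flipAt l (flipAt j S) := by
  by_cases h : j = l
  · rw [h]
  · simp [flipAt, Function.update_comm h, Ne.symm h, h]

theorem flipAt_ne (j : Fin m) (S : Fin m → Bool) : flipAt j S ≠ S := by
  intro h
  have := congrFun h j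
  simp [flipAt] at this

/-- The action of a generator by a signed permutation. -/
def reprGen (j : Fin m) : Module.End ℝ ((Fin m → Bool) → ℝ) where
  toFun F S := reprSign j S * F (flipAt j S)
  map_add' F F' := by ext S; simp [mul_add]
  map_smul' c F := by ext S; simp [mul_left_comm]

@[simp] theorem reprGen_apply (j : Fin m) (F : (Fin m → Bool) → ℝ) (S : Fin m → Bool) :
    reprGen j F S = reprSign j S * F (flipAt j S) := rfl

/-- Flipping `l` changes `reprSign j` exactly when l ≤ j. For j ≠ l this happens in exactly one of
the two orders, so the products cancel; for j = l both products are −1. -/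
theorem reprGen_anticomm (j l : Fin m) :
    reprGen j * reprGen l + reprGen l * reprGen j = if j = l then -2 else 0 := by
  refine LinearMap.ext fun F => funext fun S => ?_
  have e : (reprGen j * reprGen l + reprGen l * reprGen j) F S =
      (reprSign j S * reprSign l (flipAt j S) + reprSign l S * reprSign j (flipAt l S) : ℤ) *
        F (flipAt l (flipAt j S)) := by
    rw [LinearMap.add_apply, Pi.add_apply, Module.End.mul_apply, Module.End.mul_apply,
      reprGen_apply, reprGen_apply, reprGen_apply, reprGen_apply, flipAt_comm j l]
    push_cast
    ring
  rw [e, reprSign_flipAt, reprSign_flipAt]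
  split_ifs with h1 h2 h3 h3 h2 h3 h3 <;> try omega
  · subst h3
    have := reprSign_mul_self j S
    have e2 : reprSign j S * (-1 * reprSign j S) + reprSign j S * (-1 * reprSign j S) = -2 := by
      linarith
    rw [e2, flipAt_flipAt]
    have : (-2 : Module.End ℝ ((Fin m → Bool) → ℝ)) = (-2 : ℝ) • 1 := by
      rw [← Algebra.algebraMap_eq_smul_one, map_neg, map_ofNat]
    rw [this]
    simp
  · simp only [LinearMap.zero_apply, Pi.zero_apply, mul_eq_zero, Int.cast_eq_zero]
    left; ring
  · simp only [LinearMap.zero_apply, Pi.zero_apply, mul_eq_zero, Int.cast_eq_zero]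
    left; ring

end repr

variable {n : ℕ}

theorem cliffordForm_apply (v : Fin (n - 1) → ℝ) : cliffordForm n v = -∑ j, v j * v j := by
  simp [cliffordForm, QuadraticMap.weightedSumSquares_apply]

theorem sum_smul_reprGen_sq (v : Fin (n - 1) → ℝ) :
    (∑ j, v j • reprGen j) * (∑ j, v j • reprGen j) =
      algebraMap ℝ (Module.End ℝ ((Fin (n - 1) → Bool) → ℝ)) (cliffordForm n v) := by
  have e1 : (∑ j, v j • reprGen j) * (∑ j, v j • reprGen j) =
      ∑ j, ∑ l, (v j * v l) • (reprGen j * reprGen l) := by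
    simp only [Finset.sum_mul, Finset.mul_sum, smul_mul_smul_comm]
    exact Finset.sum_comm
  have e2 : (∑ j, v j • reprGen j) * (∑ j, v j • reprGen j) =
      ∑ j, ∑ l, (v j * v l) • (reprGen l * reprGen j) := by
    rw [e1, Finset.sum_comm]
    simp only [mul_comm]
  have e3 : (2 : ℝ) • ((∑ j, v j • reprGen j) * (∑ j, v j • reprGen j)) =
      (2 : ℝ) • algebraMap ℝ (Module.End ℝ ((Fin (n - 1) → Bool) → ℝ)) (cliffordForm n v) := by
    rw [two_smul]
    nth_rw 1 [e1]
    rw [e2, ← Finset.sum_add_distrib]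
    simp only [← Finset.sum_add_distrib, ← smul_add, reprGen_anticomm]
    simp only [smul_ite, smul_zero, Finset.sum_ite_eq, Finset.mem_univ, if_true]
    rw [cliffordForm_apply, Algebra.algebraMap_eq_smul_one, ← Finset.sum_smul, smul_smul]
    have : (-2 : Module.End ℝ ((Fin (n - 1) → Bool) → ℝ)) = (-2 : ℝ) • 1 := by
      rw [← Algebra.algebraMap_eq_smul_one, map_neg, map_ofNat]
    rw [this, smul_smul]
    congr 1
    ring
  exact smul_right_injective _ (two_ne_zero' ℝ) e3

/-- The representation of the Clifford algebra by signed permutations. -/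
noncomputable def repr (n : ℕ) : Cliff n →ₐ[ℝ] Module.End ℝ ((Fin (n - 1) → Bool) → ℝ) :=
  CliffordAlgebra.lift (cliffordForm n)
    ⟨∑ j, (LinearMap.proj j : (Fin (n - 1) → ℝ) →ₗ[ℝ] ℝ).smulRight (reprGen j), fun v => by
      simpa using sum_smul_reprGen_sq v⟩

theorem repr_ι (v : Fin (n - 1) → ℝ) :
    repr n (CliffordAlgebra.ι _ v) = ∑ j, v j • reprGen j := by
  simp [repr]

/-- The real part of an element of the Clifford algebra. -/
noncomputable def re : Cliff n →ₗ[ℝ] ℝ :=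
  (LinearMap.proj (fun _ => false)).comp
    (((LinearMap.applyₗ (Pi.single (fun _ => false) (1 : ℝ))) :
      Module.End ℝ ((Fin (n - 1) → Bool) → ℝ) →ₗ[ℝ] _).comp (repr n).toLinearMap)

theorem re_apply (x : Cliff n) :
    re x = repr n x (Pi.single (fun _ => false) 1) (fun _ => false) := rfl

@[simp] theorem re_algebraMap (r : ℝ) : re (algebraMap ℝ (Cliff n) r) = r := by
  rw [re_apply, AlgHom.commutes, Module.algebraMap_end_apply]
  simp

@[simp] theorem re_one : re (1 : Cliff n) = 1 := by
  simpa using re_algebraMap (n := n) 1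

@[simp] theorem re_ι (v : Fin (n - 1) → ℝ) : re (CliffordAlgebra.ι (cliffordForm n) v) = 0 := by
  rw [re_apply, repr_ι, LinearMap.sum_apply, Finset.sum_apply]
  refine Finset.sum_eq_zero fun j _ => ?_
  simp [flipAt_ne]

@[simp] theorem re_ι_mul_ι (v w : Fin (n - 1) → ℝ) :
    re (CliffordAlgebra.ι (cliffordForm n) v * CliffordAlgebra.ι (cliffordForm n) w) =
      -∑ j, v j * w j := by
  rw [re_apply, map_mul, repr_ι, repr_ι, Module.End.mul_apply, LinearMap.sum_apply,
    Finset.sum_apply, ← Finset.sum_neg_distrib]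
  refine Finset.sum_congr rfl fun j _ => ?_
  rw [LinearMap.smul_apply, Pi.smul_apply, reprGen_apply, LinearMap.sum_apply, Finset.sum_apply,
    Finset.sum_eq_single j]
  · have h := reprSign_mul_self j (fun _ => false)
    have h' : (reprSign j (fun _ => false) : ℝ) * reprSign j (fun _ => false) = 1 := by
      exact_mod_cast h
    rw [LinearMap.smul_apply, Pi.smul_apply, reprGen_apply, flipAt_flipAt, Pi.single_eq_same,
      reprSign_flipAt, if_pos le_rfl]
    push_cast
    rw [smul_eq_mul, smul_eq_mul]
    linear_combination (-(v j * w j)) * h'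
  · intro l _ hl
    have : flipAt l (flipAt j fun _ => false) ≠ fun _ => false := fun h => by
      have := congrFun h l
      simp [flipAt, hl] at this
    simp [this]
  · simp

/-- Signed permutations preserve integer-valued functions. This makes `re` integral on 𝒞ₙ(ℤ), the
source of every integer in the argument. -/
theorem repr_integral {x : Cliff n} (hx : x ∈ integral n) (F : (Fin (n - 1) → Bool) → ℝ)
    (hF : ∀ S, ∃ z : ℤ, F S = z) (S : Fin (n - 1) → Bool) : ∃ z : ℤ, repr n x F S = z := by
  induction hx using Subring.closure_induction generalizing F S with
  | mem x hx =>
    obtain ⟨j, rfl⟩ := hx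
    obtain ⟨z, hz⟩ := hF (flipAt j S)
    refine ⟨reprSign j S * z, ?_⟩
    rw [gen, repr_ι, LinearMap.sum_apply, Finset.sum_apply, Finset.sum_eq_single j]
    · simp [hz]
    · intro l _ hl; simp [hl]
    · simp
  | zero => exact ⟨0, by simp⟩
  | one => simpa using hF S
  | add x y _ _ hx hy =>
    obtain ⟨a, ha⟩ := hx F hF S
    obtain ⟨b, hb⟩ := hy F hF S
    exact ⟨a + b, by simp [ha, hb]⟩
  | neg x _ hx =>
    obtain ⟨a, ha⟩ := hx F hF S
    exact ⟨-a, by simp [ha]⟩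
  | mul x y _ _ hx hy =>
    rw [map_mul]
    exact hx _ (hy F hF) S

theorem re_integral {x : Cliff n} (hx : x ∈ integral n) : ∃ z : ℤ, re x = z :=
  repr_integral hx _ (fun S => by
    by_cases h : S = fun _ => false
    · exact ⟨1, by simp [h]⟩
    · exact ⟨0, by simp [h]⟩) _

instance : Nontrivial (Cliff n) :=
  ⟨0, 1, fun h => by
    have := congrArg re h
    simp at this⟩

theorem algebraMap_inj {r s : ℝ} : algebraMap ℝ (Cliff n) r = algebraMap ℝ (Cliff n) s ↔ r = s :=
  (algebraMap ℝ (Cliff n)).injective.eq_iff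

/-! ### The inner product on vectors -/

/-- The bilinear form `re (u * star v)`, whose restriction to vectors is the Euclidean inner
product. -/
noncomputable def ip : Cliff n →ₗ[ℝ] Cliff n →ₗ[ℝ] ℝ :=
  LinearMap.mk₂ ℝ (fun u v => re (u * star v)) (by simp [add_mul]) (by simp) (by simp [mul_add])
    (by simp)

theorem ip_apply (u v : Cliff n) : ip u v = re (u * star v) := rfl

theorem ip_vec (r s : ℝ) (v w : Fin (n - 1) → ℝ) :
    ip (algebraMap ℝ (Cliff n) r + CliffordAlgebra.ι _ v)
      (algebraMap ℝ _ s + CliffordAlgebra.ι _ w) = r * s + ∑ j, v j * w j := by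
  have e : (algebraMap ℝ (Cliff n) r + CliffordAlgebra.ι _ v) *
      star (algebraMap ℝ _ s + CliffordAlgebra.ι _ w) =
      algebraMap ℝ _ (r * s) - r • CliffordAlgebra.ι _ w + s • CliffordAlgebra.ι _ v -
        CliffordAlgebra.ι (cliffordForm n) v * CliffordAlgebra.ι _ w := by
    rw [star_add, CliffordAlgebra.star_ι, CliffordAlgebra.star_algebraMap]
    simp only [Algebra.algebraMap_eq_smul_one, add_mul, mul_add, smul_mul_assoc, mul_smul_comm,
      one_mul, mul_one, mul_neg]
    module
  rw [ip_apply, e, map_sub, map_add, map_sub, re_algebraMap, map_smul, map_smul, re_ι, re_ι,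
    re_ι_mul_ι]
  simp

theorem star_mem_V {x : Cliff n} (hx : x ∈ V n) : star x ∈ V n := by
  obtain ⟨r, v, rfl⟩ := mem_V.1 hx
  exact mem_V.2 ⟨r, -v, by simp⟩

theorem algebraMap_mem_V (r : ℝ) : algebraMap ℝ (Cliff n) r ∈ V n := mem_V.2 ⟨r, 0, by simp⟩

theorem mul_star_add {x y : Cliff n} (hx : x ∈ V n) (hy : y ∈ V n) :
    x * star y + y * star x = algebraMap ℝ _ (2 * ip x y) := by
  obtain ⟨r, v, rfl⟩ := mem_V.1 hx
  obtain ⟨s, w, rfl⟩ := mem_V.1 hy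
  have h := CliffordAlgebra.ι_mul_ι_add_swap (Q := cliffordForm n) v w
  have hp : QuadraticMap.polar (cliffordForm n) v w = -(2 * ∑ j, v j * w j) := by
    simp only [QuadraticMap.polar, cliffordForm_apply, Pi.add_apply, Finset.mul_sum,
      ← Finset.sum_neg_distrib, ← Finset.sum_sub_distrib]
    refine Finset.sum_congr rfl fun j _ => ?_
    ring
  rw [hp] at h
  rw [ip_vec]
  have h' := congrArg (fun z => -z) h
  simp only [← map_neg, neg_neg] at h'
  rw [mul_add, map_add, ← h']
  simp only [star_add, CliffordAlgebra.star_ι, CliffordAlgebra.star_algebraMap]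
  simp only [add_mul, mul_add, Algebra.algebraMap_eq_smul_one, smul_mul_assoc, mul_smul_comm,
    one_mul, mul_one, mul_neg]
  module

theorem mul_star_self {x : Cliff n} (hx : x ∈ V n) : x * star x = algebraMap ℝ _ (ip x x) := by
  have h := mul_star_add hx hx
  rw [← two_smul ℝ, mul_comm, map_mul, ← Algebra.commutes, ← Algebra.smul_def] at h
  exact smul_right_injective _ (two_ne_zero' ℝ) h

theorem ip_comm {x y : Cliff n} (hx : x ∈ V n) (hy : y ∈ V n) : ip x y = ip y x := by
  obtain ⟨r, v, rfl⟩ := mem_V.1 hx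
  obtain ⟨s, w, rfl⟩ := mem_V.1 hy
  simp only [ip_vec, mul_comm]

theorem ip_self_nonneg {x : Cliff n} (hx : x ∈ V n) : 0 ≤ ip x x := by
  obtain ⟨r, v, rfl⟩ := mem_V.1 hx
  rw [ip_vec]
  exact add_nonneg (mul_self_nonneg _) (Finset.sum_nonneg fun _ _ => mul_self_nonneg _)

theorem eq_zero_of_ip_self {x : Cliff n} (hx : x ∈ V n) (h : ip x x = 0) : x = 0 := by
  obtain ⟨r, v, rfl⟩ := mem_V.1 hx
  rw [ip_vec] at h
  have h1 : 0 ≤ ∑ j, v j * v j := Finset.sum_nonneg fun _ _ => mul_self_nonneg _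
  have h2 : r = 0 := by nlinarith [mul_self_nonneg r]
  subst h2
  have h3 : ∑ j, v j * v j = 0 := by linarith
  rw [Finset.sum_eq_zero_iff_of_nonneg fun _ _ => mul_self_nonneg _] at h3
  have : v = 0 := by
    ext j
    simpa using h3 j (Finset.mem_univ j)
  simp [this]

theorem ip_star {x y : Cliff n} (hx : x ∈ V n) (hy : y ∈ V n) : ip (star x) (star y) = ip x y := by
  obtain ⟨r, v, rfl⟩ := mem_V.1 hx
  obtain ⟨s, w, rfl⟩ := mem_V.1 hy
  have := ip_vec (n := n) r s (-v) (-w)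
  simp only [map_neg, Pi.neg_apply, neg_mul_neg] at this
  rw [ip_vec, ← this]
  simp

theorem star_mul_self_V {x : Cliff n} (hx : x ∈ V n) :
    star x * x = algebraMap ℝ _ (ip x x) := by
  have := mul_star_self (star_mem_V hx)
  rwa [star_star, ip_star hx hx] at this

theorem ip_sq_le {x y : Cliff n} (hx : x ∈ V n) (hy : y ∈ V n) :
    ip x y ^ 2 ≤ ip x x * ip y y := by
  by_cases h : ip y y = 0
  · rw [eq_zero_of_ip_self hy h]; simp
  have hy0 := lt_of_le_of_ne (ip_self_nonneg hy) (Ne.symm h)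
  have h1 := ip_self_nonneg (sub_mem ((V n).smul_mem (ip y y) hx) ((V n).smul_mem (ip x y) hy))
  simp only [map_sub, map_smul, LinearMap.sub_apply, LinearMap.smul_apply, smul_eq_mul,
    ip_comm hy hx] at h1
  have h2 : 0 ≤ ip y y * (ip x x * ip y y - ip x y ^ 2) := by nlinarith
  have := nonneg_of_mul_nonneg_right h2 hy0
  linarith

/-! ### Norms of elements of the Clifford group -/

theorem exists_norm_of_mem_Gam {u : (Cliff n)ˣ} (hu : u ∈ Gam n) :
    ∃ t : ℝ, 0 < t ∧ (u : Cliff n) * star (u : Cliff n) = algebraMap ℝ _ t ∧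
      star (u : Cliff n) * (u : Cliff n) = algebraMap ℝ _ t := by
  induction hu using Subgroup.closure_induction with
  | mem u hu =>
    refine ⟨ip (u : Cliff n) u, lt_of_le_of_ne (ip_self_nonneg hu) fun h => ?_,
      mul_star_self hu, star_mul_self_V hu⟩
    exact u.ne_zero (eq_zero_of_ip_self hu h.symm)
  | one => exact ⟨1, one_pos, by simp, by simp⟩
  | mul u w _ _ hu hw =>
    obtain ⟨s, hs, h1, h2⟩ := hu
    obtain ⟨t, ht, h3, h4⟩ := hw
    refine ⟨s * t, mul_pos hs ht, ?_, ?_⟩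
    · calc ((u * w : (Cliff n)ˣ) : Cliff n) * star ((u * w : (Cliff n)ˣ) : Cliff n)
          = u * (w * star (w : Cliff n)) * star (u : Cliff n) := by
            rw [Units.val_mul, star_mul]; noncomm_ring
        _ = _ := by rw [h3, ← Algebra.commutes, mul_assoc, h1, ← map_mul, mul_comm]
    · calc star ((u * w : (Cliff n)ˣ) : Cliff n) * ((u * w : (Cliff n)ˣ) : Cliff n)
          = star (w : Cliff n) * (star (u : Cliff n) * u) * w := by
            rw [Units.val_mul, star_mul]; noncomm_ring
        _ = _ := by rw [h2, ← Algebra.commutes, mul_assoc, h4, ← map_mul]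
  | inv u _ hu =>
    obtain ⟨s, hs, h1, h2⟩ := hu
    have e : (s⁻¹ * s : ℝ) = 1 := inv_mul_cancel₀ hs.ne'
    have hi : ((u⁻¹ : (Cliff n)ˣ) : Cliff n) = algebraMap ℝ _ s⁻¹ * star (u : Cliff n) :=
      Units.inv_eq_of_mul_eq_one_left (by rw [mul_assoc, h2, ← map_mul, e, map_one])
    refine ⟨s⁻¹, inv_pos.2 hs, ?_, ?_⟩
    · rw [hi, star_mul, star_star, CliffordAlgebra.star_algebraMap, ← Algebra.commutes,
        mul_assoc (algebraMap ℝ _ s⁻¹), ← mul_assoc (star (u : Cliff n)),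
        ← Algebra.commutes s⁻¹ (star (u : Cliff n)), mul_assoc, h2, ← map_mul, ← map_mul, e,
        mul_one]
    · rw [hi, star_mul, star_star, CliffordAlgebra.star_algebraMap, ← Algebra.commutes,
        mul_assoc (algebraMap ℝ _ s⁻¹), ← mul_assoc (u : Cliff n),
        ← Algebra.commutes s⁻¹ (u : Cliff n), mul_assoc, h1, ← map_mul, ← map_mul, e,
        mul_one]

theorem exists_norm_of_mem_Gam0 {a : Cliff n} (ha : a ∈ Gam0 n) :
    ∃ t : ℝ, 0 ≤ t ∧ a * star a = algebraMap ℝ _ t := by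
  rcases ha with rfl | ⟨u, hu, rfl⟩
  · exact ⟨0, le_rfl, by simp⟩
  · obtain ⟨t, ht, h, -⟩ := exists_norm_of_mem_Gam hu
    exact ⟨t, ht.le, h⟩

/-! ### Integral elements modulo two -/

theorem star_mem_integral {a : Cliff n} (ha : a ∈ integral n) : star a ∈ integral n := by
  induction ha using Subring.closure_induction with
  | mem x hx =>
    obtain ⟨j, rfl⟩ := hx
    rw [gen, CliffordAlgebra.star_ι]
    exact neg_mem (Subring.subset_closure ⟨j, rfl⟩)
  | zero => rw [star_zero]; exact zero_mem _
  | one => rw [star_one]; exact one_mem _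
  | add x y _ _ hx hy => rw [star_add]; exact add_mem hx hy
  | neg x _ hx => rw [star_neg]; exact neg_mem hx
  | mul x y _ _ hx hy => rw [star_mul]; exact mul_mem hy hx

/-- The ideal `2 𝒞ₙ(ℤ)` of the integral Clifford algebra, as an additive subgroup. -/
noncomputable def evenPart (n : ℕ) : AddSubgroup (Cliff n) where
  carrier := {x | ∃ j ∈ integral n, x = 2 * j}
  zero_mem' := ⟨0, zero_mem _, by simp⟩
  add_mem' := by
    rintro _ _ ⟨j, hj, rfl⟩ ⟨k, hk, rfl⟩
    exact ⟨j + k, add_mem hj hk, (mul_add _ _ _).symm⟩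
  neg_mem' := by
    rintro _ ⟨j, hj, rfl⟩
    exact ⟨-j, neg_mem hj, by simp⟩

theorem mul_mem_evenPart_left {a x : Cliff n} (ha : a ∈ integral n) (hx : x ∈ evenPart n) :
    a * x ∈ evenPart n := by
  obtain ⟨j, hj, rfl⟩ := hx
  exact ⟨a * j, mul_mem ha hj, by noncomm_ring⟩

theorem mul_mem_evenPart_right {a x : Cliff n} (ha : a ∈ integral n) (hx : x ∈ evenPart n) :
    x * a ∈ evenPart n := by
  obtain ⟨j, hj, rfl⟩ := hx
  exact ⟨j * a, mul_mem hj ha, by noncomm_ring⟩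

theorem gen_sq (j : Fin (n - 1)) : gen n j * gen n j = -1 := by
  rw [gen, CliffordAlgebra.ι_sq_scalar, cliffordForm_apply, Finset.sum_eq_single j]
  · simp
  · intro l _ hl; simp [hl]
  · simp

theorem gen_anticomm {j l : Fin (n - 1)} (h : j ≠ l) :
    gen n j * gen n l = -(gen n l * gen n j) := by
  have := CliffordAlgebra.ι_mul_ι_add_swap (Q := cliffordForm n) (Pi.single j 1) (Pi.single l 1)
  rw [eq_neg_iff_add_eq_zero]
  refine this.trans ?_
  have hp : QuadraticMap.polar (cliffordForm n) (Pi.single j 1) (Pi.single l 1) = 0 := by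
    simp only [QuadraticMap.polar, cliffordForm_apply, Pi.add_apply,
      ← Finset.sum_neg_distrib, ← Finset.sum_sub_distrib]
    refine Finset.sum_eq_zero fun k _ => ?_
    by_cases h1 : k = j
    · subst h1; simp [h]
    · simp [h1]
  rw [hp, map_zero]

/-- Generators commute up to sign, hence modulo 2; the Leibniz rule for commutators extends this to
products. -/
theorem commutator_mem_evenPart {x y : Cliff n} (hx : x ∈ integral n) (hy : y ∈ integral n) :
    x * y - y * x ∈ evenPart n := by
  induction hx using Subring.closure_induction with
  | mem x hx =>
    obtain ⟨j, rfl⟩ := hx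
    induction hy using Subring.closure_induction with
    | mem y hy =>
      obtain ⟨l, rfl⟩ := hy
      by_cases h : j = l
      · subst h; rw [sub_self]; exact zero_mem _
      · refine ⟨gen n j * gen n l, mul_mem (Subring.subset_closure ⟨j, rfl⟩)
          (Subring.subset_closure ⟨l, rfl⟩), ?_⟩
        rw [gen_anticomm (Ne.symm h)]; noncomm_ring
    | zero => simp [zero_mem]
    | one => simp [zero_mem]
    | add y z _ _ hy hz =>
      convert add_mem hy hz using 1; noncomm_ring
    | neg y _ hy => convert neg_mem hy using 1; noncomm_ring
    | mul y z hy' hz' hy hz =>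
      convert add_mem (mul_mem_evenPart_right hz' hy) (mul_mem_evenPart_left hy' hz) using 1
      noncomm_ring
  | zero => simp [zero_mem]
  | one => simp [zero_mem]
  | add y z _ _ hy hz =>
    convert add_mem hy hz using 1; noncomm_ring
  | neg y _ hy => convert neg_mem hy using 1; noncomm_ring
  | mul u z hu' hz' hu hz =>
    convert add_mem (mul_mem_evenPart_right hz' hu) (mul_mem_evenPart_left hu' hz) using 1
    noncomm_ring

/-- Modulo 2 the sign on generators disappears, and reversing a product is harmless by
commutativity. -/
theorem star_sub_mem_evenPart {x : Cliff n} (hx : x ∈ integral n) : star x - x ∈ evenPart n := by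
  induction hx using Subring.closure_induction with
  | mem x hx =>
    obtain ⟨j, rfl⟩ := hx
    refine ⟨-gen n j, neg_mem (Subring.subset_closure ⟨j, rfl⟩), ?_⟩
    rw [gen, CliffordAlgebra.star_ι]; noncomm_ring
  | zero => simp [zero_mem]
  | one => simp [zero_mem]
  | add y z _ _ hy hz =>
    convert add_mem hy hz using 1; rw [star_add]; abel
  | neg y _ hy => convert neg_mem hy using 1; rw [star_neg]; abel
  | mul u z hu' hz' hu hz =>
    convert add_mem (add_mem (mul_mem_evenPart_right (star_mem_integral hu') hz)
      (mul_mem_evenPart_left hz' hu)) (commutator_mem_evenPart hz' hu') using 1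
    rw [star_mul]; noncomm_ring

theorem rev_sub_mem_evenPart {x : Cliff n} (hx : x ∈ integral n) : rev x - x ∈ evenPart n := by
  induction hx using Subring.closure_induction with
  | mem x hx =>
    obtain ⟨j, rfl⟩ := hx
    rw [rev, gen, CliffordAlgebra.reverse_ι, sub_self]
    exact zero_mem _
  | zero => simp [zero_mem]
  | one => simp [zero_mem]
  | add y z _ _ hy hz =>
    convert add_mem hy hz using 1; rw [rev_add]; abel
  | neg y _ hy => convert neg_mem hy using 1; rw [rev_neg]; abel
  | mul u z hu' hz' hu hz =>
    convert add_mem (add_mem (mul_mem_evenPart_right (rev_mem_integral hu') hz)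
      (mul_mem_evenPart_left hz' hu)) (commutator_mem_evenPart hz' hu') using 1
    rw [rev_mul]; noncomm_ring

end Cliff

/-! ### The action on Hermitian matrices -/

/-- The inequality of arithmetic and geometric means. Fed with Cauchy–Schwarz, it determines the
sign of the pairing of two vectors in the closed light cone. -/
theorem add_add_two_mul_nonneg {A B p : ℝ} (hA : 0 ≤ A) (hB : 0 ≤ B) (h : p ^ 2 ≤ A * B) :
    0 ≤ A + B + 2 * p := by
  have h1 : (-(2 * p)) ^ 2 ≤ (A + B) ^ 2 := by nlinarith [sq_nonneg (A - B)]
  linarith [le_abs_self (-(2 * p)), abs_le_of_sq_le_sq h1 (add_nonneg hA hB)]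

namespace Cliff

variable {n : ℕ}

theorem star_mem_Gam0 {a : Cliff n} (ha : a ∈ Gam0 n) : star a ∈ Gam0 n := by
  rcases ha with rfl | ⟨u, hu, rfl⟩
  · rw [star_zero]; exact zero_mem_Gam0
  obtain ⟨t, ht, h, -⟩ := exists_norm_of_mem_Gam hu
  have : star (u : Cliff n) = ((u⁻¹ : (Cliff n)ˣ) : Cliff n) * algebraMap ℝ _ t := by
    rw [← h, Units.inv_mul_cancel_left]
  rw [this]
  exact mul_mem_Gam0 (Or.inr ⟨_, inv_mem hu, rfl⟩) (mem_Gam0_of_mem_V (algebraMap_mem_V t))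

theorem star_rev (a : Cliff n) : star (rev a) = CliffordAlgebra.involute a := by
  rw [CliffordAlgebra.star_def', rev, CliffordAlgebra.reverse_reverse]

theorem rev_star (a : Cliff n) : rev (star a) = CliffordAlgebra.involute a := by
  rw [CliffordAlgebra.star_def, rev, CliffordAlgebra.reverse_reverse]

theorem involute_star (a : Cliff n) : CliffordAlgebra.involute (star a) = rev a := by
  rw [CliffordAlgebra.star_def', CliffordAlgebra.involute_involute, rev]

theorem involute_of_mem_V {v : Cliff n} (hv : v ∈ V n) :
    CliffordAlgebra.involute v = star v := by
  rw [← star_rev, rev_of_mem_V hv]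

/-- A row of a matrix in `SL₊(Γₙ(ℝ))` evaluates a Hermitian form to a real number. -/
theorem exists_row_form {a b v : Cliff n} (ha : a ∈ Gam0 n) (hb : b ∈ Gam0 n)
    (hab : a * rev b ∈ V n) (hv : v ∈ V n) (x y : ℝ) :
    ∃ t : ℝ, a * algebraMap ℝ _ x * star a + a * v * star b + b * star v * star a +
      b * algebraMap ℝ _ y * star b = algebraMap ℝ _ t ∧
      (0 ≤ x → 0 ≤ y → ip v v ≤ x * y → 0 ≤ t) := by
  rcases ha with rfl | ⟨u, hu, rfl⟩
  · obtain ⟨t, ht, h⟩ := exists_norm_of_mem_Gam0 hb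
    refine ⟨y * t, ?_, fun _ hy _ => mul_nonneg hy ht⟩
    rw [← Algebra.commutes y, mul_assoc (algebraMap ℝ _ y), h, map_mul]
    simp
  · obtain ⟨t, ht, h, -⟩ := exists_norm_of_mem_Gam hu
    -- The row condition makes w = a⁻¹b a vector, so the form is the norm of `a` times x + 2⟨v, w⟩ +
    -- y|w|².
    have hw := inv_mul_mem_V hu hab
    generalize hwd : ((u⁻¹ : (Cliff n)ˣ) : Cliff n) * b = w at hw
    have hbw : b = u * w := by rw [← hwd]; simp
    refine ⟨(x + 2 * ip v w + y * ip w w) * t, ?_, fun hx hy hxy => ?_⟩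
    · subst hbw
      calc _ = (u : Cliff n) * (algebraMap ℝ _ x + (v * star w + w * star v) +
              w * algebraMap ℝ _ y * star w) * star (u : Cliff n) := by
            rw [star_mul]; noncomm_ring
        _ = _ := by
            rw [mul_star_add hv hw, ← Algebra.commutes y, mul_assoc (algebraMap ℝ _ y),
              mul_star_self hw, ← map_mul, ← map_add, ← map_add, ← Algebra.commutes, mul_assoc, h,
              ← map_mul]
    · refine mul_nonneg ?_ ht.le
      have h1 := ip_sq_le hv hw
      have h2 := ip_self_nonneg hw
      have := add_add_two_mul_nonneg (p := ip v w) hx (mul_nonneg hy h2) (by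
        calc _ ≤ _ := h1
          _ ≤ x * y * ip w w := mul_le_mul_of_nonneg_right hxy h2
          _ = _ := by ring)
      linarith

/-- A Bruhat decomposition. If c = 0, then d* = a⁻¹ and the entry is a real combination of a v a*
and b a*. If c ≠ 0, then a = s c and d = c u with vectors `s`, `u`, and the determinant gives b = s
c u − (c*)⁻¹; the entry is `s` times the real value of the lower row, minus a conjugate of a vector.
-/
theorem offdiag_mem_V {M : Matrix (Fin 2) (Fin 2) (Cliff n)} (hM : IsSLPlus M) {v : Cliff n}
    (hv : v ∈ V n) (x y : ℝ) :
    M 0 0 * algebraMap ℝ _ x * star (M 1 0) + M 0 0 * v * star (M 1 1) +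
      M 0 1 * star v * star (M 1 0) + M 0 1 * algebraMap ℝ _ y * star (M 1 1) ∈ V n := by
  have hdet := hM.det_eq
  have hrow := hM.row₀
  have hrow1 := hM.row₁
  have hcol := hM.col₀
  have ha := hM.entries 0 0
  have hc := hM.entries 1 0
  generalize M 0 0 = a at *
  generalize M 0 1 = b at *
  generalize M 1 0 = c at *
  generalize M 1 1 = d at *
  rcases hc with rfl | ⟨w, hw, rfl⟩
  · rw [rev_zero, mul_zero, sub_zero] at hdet
    rcases ha with rfl | ⟨u, hu, rfl⟩
    · simp at hdet
    obtain ⟨t, ht, h, -⟩ := exists_norm_of_mem_Gam hu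
    have h1 : star (u : Cliff n) = algebraMap ℝ _ t * rev d := by
      rw [← h]
      have h2 : rev d = ((u⁻¹ : (Cliff n)ˣ) : Cliff n) :=
        (Units.inv_eq_of_mul_eq_one_right hdet).symm
      have h3 : star (u : Cliff n) * (u : Cliff n) = algebraMap ℝ _ t := by
        have : star (u : Cliff n) = ((u⁻¹ : (Cliff n)ˣ) : Cliff n) * algebraMap ℝ _ t := by
          rw [← h, Units.inv_mul_cancel_left]
        rw [this, ← Algebra.commutes, mul_assoc, Units.inv_mul, mul_one]
      rw [h, h2, ← h3, mul_assoc, Units.mul_inv, mul_one]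
    have h2 : rev (u : Cliff n) = algebraMap ℝ _ t * star d := by
      have := congrArg CliffordAlgebra.involute h1
      rw [involute_star, map_mul, AlgHom.commutes] at this
      rw [this, CliffordAlgebra.star_def', rev]
    have h3 : star d = t⁻¹ • rev (u : Cliff n) := by
      rw [h2, ← Algebra.smul_def, inv_smul_smul₀ ht.ne']
    rw [star_zero, mul_zero, mul_zero, zero_add, add_zero, h3, mul_smul_comm, mul_smul_comm,
      ← Algebra.commutes, ← Algebra.smul_def, smul_mul_assoc, comm_of_mem_V hrow]
    exact add_mem ((V n).smul_mem _ (conj_mem_V hu hv))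
      ((V n).smul_mem _ ((V n).smul_mem _ hrow))
  · obtain ⟨t, ht, h, h'⟩ := exists_norm_of_mem_Gam hw
    have hs := mul_inv_mem_V hw hcol
    have hu := inv_mul_mem_V hw hrow1
    generalize hsd : a * ((w⁻¹ : (Cliff n)ˣ) : Cliff n) = s at hs
    generalize hud : ((w⁻¹ : (Cliff n)ˣ) : Cliff n) * d = u at hu
    have ea : a = s * w := by rw [← hsd]; simp
    have ed : d = w * u := by rw [← hud]; simp
    have hk : star (w : Cliff n) ∈ Gam0 n := star_mem_Gam0 (Or.inr ⟨w, hw, rfl⟩)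
    have h1 : rev (w : Cliff n) * rev (star (w : Cliff n)) = algebraMap ℝ _ t := by
      rw [← rev_mul, h', rev_of_mem_V (algebraMap_mem_V t)]
    have h2 : b * algebraMap ℝ _ t =
        s * w * u * algebraMap ℝ _ t - rev (star (w : Cliff n)) := by
      rw [ea, ed, rev_mul, rev_of_mem_V hu] at hdet
      have h3 : b * rev (w : Cliff n) = s * w * (u * rev (w : Cliff n)) - 1 := by
        rw [← hdet]; abel
      rw [← h1, ← mul_assoc, h3]
      noncomm_ring
    have eb : b = s * w * u - t⁻¹ • rev (star (w : Cliff n)) := by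
      rw [← Algebra.commutes, ← Algebra.smul_def, ← Algebra.commutes, ← Algebra.smul_def] at h2
      have := congrArg (fun z => t⁻¹ • z) h2
      simpa only [smul_sub, inv_smul_smul₀ ht.ne'] using this
    obtain ⟨r, hr, -⟩ := exists_row_form (Or.inr ⟨w, hw, rfl⟩ : (w : Cliff n) ∈ Gam0 n)
      (mul_mem_Gam0 (Or.inr ⟨w, hw, rfl⟩) (mem_Gam0_of_mem_V hu)) (b := (w : Cliff n) * u)
      (by rw [← ed]; exact hrow1) hv x y
    have e : a * algebraMap ℝ _ x * star (w : Cliff n) + a * v * star d +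
        b * star v * star (w : Cliff n) + b * algebraMap ℝ _ y * star d =
        s * ((w : Cliff n) * algebraMap ℝ _ x * star (w : Cliff n) +
          (w : Cliff n) * v * star ((w : Cliff n) * u) +
          (w : Cliff n) * u * star v * star (w : Cliff n) +
          (w : Cliff n) * u * algebraMap ℝ _ y * star ((w : Cliff n) * u)) -
        t⁻¹ • (rev (star (w : Cliff n)) * (star v + y • star u) * star (w : Cliff n)) := by
      rw [ea, ed, eb, star_mul]
      simp only [Algebra.algebraMap_eq_smul_one, sub_mul, mul_add, add_mul, smul_mul_assoc,
        mul_smul_comm, mul_one, smul_add, smul_sub, mul_assoc]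
      module
    rw [e, hr, ← Algebra.commutes, ← Algebra.smul_def]
    refine sub_mem ((V n).smul_mem _ hs) ((V n).smul_mem _ ?_)
    have := conj_mem_V' (rev_mem_Gam0 hk)
      (add_mem (star_mem_V hv) ((V n).smul_mem y (star_mem_V hu)))
    rwa [rev_rev] at this

/-- The Hermitian matrix with real diagonal entries `x, y` and upper right entry `v`. -/
noncomputable def herm (x : ℝ) (v : Cliff n) (y : ℝ) : Matrix (Fin 2) (Fin 2) (Cliff n) :=
  !![algebraMap ℝ _ x, v; star v, algebraMap ℝ _ y]

theorem mul_herm_mul {M : Matrix (Fin 2) (Fin 2) (Cliff n)} (x : ℝ) (v : Cliff n) (y : ℝ)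
    (i j : Fin 2) : (M * herm x v y * Mᴴ) i j = M i 0 * algebraMap ℝ _ x * star (M j 0) +
      M i 0 * v * star (M j 1) + M i 1 * star v * star (M j 0) +
      M i 1 * algebraMap ℝ _ y * star (M j 1) := by
  simp only [herm, Matrix.mul_apply, Fin.sum_univ_two, Matrix.conjTranspose_apply, Matrix.of_apply,
    Matrix.cons_val', Matrix.cons_val_zero, Matrix.cons_val_one, Matrix.cons_val_fin_one]
  noncomm_ring

theorem exists_mul_herm_mul {M : Matrix (Fin 2) (Fin 2) (Cliff n)} (hM : IsSLPlus M) (x : ℝ)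
    {v : Cliff n} (hv : v ∈ V n) (y : ℝ) : ∃ x' y' : ℝ, ∃ v' ∈ V n,
      M * herm x v y * Mᴴ = herm x' v' y' ∧
      (0 ≤ x → 0 ≤ y → ip v v ≤ x * y → 0 ≤ x' ∧ 0 ≤ y') := by
  obtain ⟨x', hx', hx⟩ := exists_row_form (hM.entries 0 0) (hM.entries 0 1) hM.row₀ hv x y
  obtain ⟨y', hy', hy⟩ := exists_row_form (hM.entries 1 0) (hM.entries 1 1) hM.row₁ hv x y
  refine ⟨x', y', _, offdiag_mem_V hM hv x y, ?_, fun h1 h2 h3 => ⟨hx h1 h2 h3, hy h1 h2 h3⟩⟩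
  ext i j
  rw [mul_herm_mul]
  fin_cases i <;> fin_cases j
  · exact hx'
  · rfl
  · simp only [herm, Fin.mk_one, Fin.zero_eta, Matrix.of_apply, Matrix.cons_val',
      Matrix.cons_val_zero, Matrix.cons_val_one, Matrix.cons_val_fin_one, star_add, star_mul,
      star_star, CliffordAlgebra.star_algebraMap]
    noncomm_ring
  · exact hy'

/-- The adjugate of a `2 × 2` matrix, twisted by the main involution. -/
noncomputable def twistedAdj (M : Matrix (Fin 2) (Fin 2) (Cliff n)) :
    Matrix (Fin 2) (Fin 2) (Cliff n) :=
  !![0, 1; -1, 0] * (CliffordAlgebra.involute.mapMatrix M) * !![0, -1; 1, 0]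

/-- The main involution is an automorphism, whereas entrywise `star` or `rev` would reverse
products. -/
theorem twistedAdj_mul (M N : Matrix (Fin 2) (Fin 2) (Cliff n)) :
    twistedAdj (M * N) = twistedAdj M * twistedAdj N := by
  have h : (!![0, -1; 1, 0] : Matrix (Fin 2) (Fin 2) (Cliff n)) * !![0, 1; -1, 0] = 1 := by
    ext i j; fin_cases i <;> fin_cases j <;> simp
  calc _ = !![0, 1; -1, 0] * (CliffordAlgebra.involute.mapMatrix M) *
        (!![0, -1; 1, 0] * !![0, 1; -1, 0]) * (CliffordAlgebra.involute.mapMatrix N) *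
        !![0, -1; 1, 0] := by
          rw [h, mul_one, twistedAdj, map_mul]; simp only [mul_assoc]
    _ = _ := by simp only [twistedAdj, mul_assoc]

theorem twistedAdj_eq (M : Matrix (Fin 2) (Fin 2) (Cliff n)) :
    twistedAdj M = !![CliffordAlgebra.involute (M 1 1), -CliffordAlgebra.involute (M 1 0);
      -CliffordAlgebra.involute (M 0 1), CliffordAlgebra.involute (M 0 0)] := by
  ext i j
  fin_cases i <;> fin_cases j <;>
    simp [twistedAdj, Matrix.mul_apply, Fin.sum_univ_two, Matrix.vecMul, dotProduct]

theorem twistedAdj_herm (x : ℝ) {v : Cliff n} (hv : v ∈ V n) (y : ℝ) :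
    twistedAdj (herm x v y) = herm y (-v) x := by
  have h := involute_of_mem_V hv
  have h' : CliffordAlgebra.involute (star v) = v := by rw [involute_star, rev_of_mem_V hv]
  rw [twistedAdj_eq]
  ext i j
  fin_cases i <;> fin_cases j <;> simp [herm, h, h']

theorem twistedAdj_eq_adj (M : Matrix (Fin 2) (Fin 2) (Cliff n)) :
    twistedAdj M = (IsSLPlus.adj M)ᴴ := by
  rw [twistedAdj_eq]
  ext i j
  fin_cases i <;> fin_cases j <;> simp [IsSLPlus.adj, star_rev]

theorem twistedAdj_conjTranspose (M : Matrix (Fin 2) (Fin 2) (Cliff n)) :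
    twistedAdj Mᴴ = IsSLPlus.adj M := by
  rw [twistedAdj_eq]
  ext i j
  fin_cases i <;> fin_cases j <;> simp [IsSLPlus.adj, involute_star]

/-- The polarisation of h · adj(h) = det(h) · 1. -/
theorem herm_mul_add {v₁ v₂ : Cliff n} (hv₁ : v₁ ∈ V n) (hv₂ : v₂ ∈ V n) (x₁ y₁ x₂ y₂ : ℝ) :
    herm x₁ v₁ y₁ * herm y₂ (-v₂) x₂ + herm x₂ v₂ y₂ * herm y₁ (-v₁) x₁ =
      (x₁ * y₂ + x₂ * y₁ - 2 * ip v₁ v₂) • 1 := by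
  have h1 := mul_star_add hv₁ hv₂
  have h2 := mul_star_add (star_mem_V hv₁) (star_mem_V hv₂)
  rw [star_star, star_star, ip_star hv₁ hv₂] at h2
  rw [Algebra.algebraMap_eq_smul_one] at h1 h2
  ext i j
  fin_cases i <;> fin_cases j <;>
    simp only [herm, Matrix.add_apply, Matrix.mul_apply, Fin.sum_univ_two, Matrix.of_apply,
      Matrix.cons_val', Matrix.cons_val_zero, Matrix.cons_val_one, Matrix.cons_val_fin_one,
      Fin.mk_one, Fin.zero_eta, Matrix.smul_apply, Matrix.one_apply_eq, star_neg, mul_neg,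
      Algebra.algebraMap_eq_smul_one, smul_mul_assoc, mul_smul_comm, one_mul, mul_one, ne_eq,
      one_ne_zero, zero_ne_one, not_false_eq_true, Matrix.one_apply_ne, smul_zero, smul_smul]
  · rw [sub_smul, ← h1]; module
  · module
  · module
  · rw [sub_smul, ← h2]; module

/-- The action of `SL₊(Γₙ(ℝ))` on Hermitian matrices preserves the polarised determinant. -/
theorem form_eq_of_mul_herm_mul {M : Matrix (Fin 2) (Fin 2) (Cliff n)} (hM : IsSLPlus M)
    {v₁ v₂ v₁' v₂' : Cliff n} (hv₁ : v₁ ∈ V n) (hv₂ : v₂ ∈ V n) (hv₁' : v₁' ∈ V n)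
    (hv₂' : v₂' ∈ V n) {x₁ y₁ x₂ y₂ x₁' y₁' x₂' y₂' : ℝ}
    (h₁ : M * herm x₁ v₁ y₁ * Mᴴ = herm x₁' v₁' y₁')
    (h₂ : M * herm x₂ v₂ y₂ * Mᴴ = herm x₂' v₂' y₂') :
    x₁' * y₂' + x₂' * y₁' - 2 * ip v₁' v₂' = x₁ * y₂ + x₂ * y₁ - 2 * ip v₁ v₂ := by
  -- `twistedAdj` is the adjugate on Hermitian matrices and the inverse conjugate transpose on the
  -- group, so adjugates transform contragrediently. The polarised determinant, as a scalar matrix,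
  -- is then merely conjugated by `M`.
  have ht : ∀ {x y x' y' : ℝ} {v v' : Cliff n}, v ∈ V n → v' ∈ V n →
      M * herm x v y * Mᴴ = herm x' v' y' →
      herm y' (-v') x' = (IsSLPlus.adj M)ᴴ * herm y (-v) x * IsSLPlus.adj M := by
    intro x y x' y' v v' hv hv' h
    rw [← twistedAdj_herm x' hv' y', ← h, twistedAdj_mul, twistedAdj_mul, twistedAdj_herm x hv y,
      twistedAdj_eq_adj, twistedAdj_conjTranspose]
  have hc : Mᴴ * (IsSLPlus.adj M)ᴴ = 1 := by
    rw [← Matrix.conjTranspose_mul, hM.adj_mul, Matrix.conjTranspose_one]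
  have hp : ∀ A B : Matrix (Fin 2) (Fin 2) (Cliff n),
      M * A * Mᴴ * ((IsSLPlus.adj M)ᴴ * B * IsSLPlus.adj M) = M * (A * B) * IsSLPlus.adj M := by
    intro A B
    calc _ = M * A * (Mᴴ * (IsSLPlus.adj M)ᴴ) * B * IsSLPlus.adj M := by simp only [mul_assoc]
      _ = _ := by rw [hc, mul_one]; simp only [mul_assoc]
  have h := herm_mul_add hv₁' hv₂' x₁' y₁' x₂' y₂'
  rw [ht hv₁ hv₁' h₁, ht hv₂ hv₂' h₂, ← h₁, ← h₂, hp, hp, ← add_mul, ← mul_add,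
    herm_mul_add hv₁ hv₂, mul_smul_comm, mul_one, smul_mul_assoc, hM.mul_adj] at h
  have h00 := congrFun (congrFun h 0) 0
  simp only [Matrix.smul_apply, Matrix.one_apply_eq, ← Algebra.algebraMap_eq_smul_one] at h00
  exact (algebraMap_inj.1 h00).symm

end Cliff

/-! ### The cut of the modular group given by a unit vector -/

namespace Cliff

variable {n : ℕ}

/-- The coordinates are inner products with 1 and the generators, thus real parts of integral
elements. -/
theorem exists_coords_of_integral {v : Cliff n} (hv : v ∈ V n) (hi : v ∈ integral n) :
    ∃ (r : ℤ) (p : Fin (n - 1) → ℤ),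
      v = algebraMap ℝ _ (r : ℝ) + CliffordAlgebra.ι _ (fun j => (p j : ℝ)) := by
  obtain ⟨r, p, rfl⟩ := mem_V.1 hv
  obtain ⟨r', hr⟩ := re_integral hi
  have hp : ∀ j, ∃ z : ℤ, p j = z := by
    intro j
    obtain ⟨z, hz⟩ := re_integral (mul_mem hi
      (star_mem_integral (Subring.subset_closure ⟨j, rfl⟩ : gen n j ∈ integral n)))
    have h := ip_vec (n := n) r 0 p (Pi.single j 1)
    rw [map_zero, zero_add, ip_apply] at h
    rw [gen, h] at hz
    exact ⟨z, by simpa [Pi.single_apply] using hz⟩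
  choose p' hp' using hp
  refine ⟨r', p', ?_⟩
  rw [map_add, re_algebraMap, re_ι, add_zero] at hr
  rw [← hr, ← funext hp']

theorem finite_integral_vectors (C : ℝ) :
    {v : Cliff n | v ∈ V n ∧ v ∈ integral n ∧ ip v v ≤ C}.Finite := by
  obtain ⟨N, hN⟩ := exists_int_gt C
  have hfin : (Set.Icc (-N) N ×ˢ Set.Icc (fun _ : Fin (n - 1) => -N) (fun _ => N)).Finite :=
    (Set.finite_Icc _ _).prod (Set.finite_Icc _ _)
  refine (hfin.image fun q : ℤ × (Fin (n - 1) → ℤ) =>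
    algebraMap ℝ (Cliff n) (q.1 : ℝ) + CliffordAlgebra.ι _ (fun j => (q.2 j : ℝ))).subset ?_
  rintro v ⟨hv, hi, hC⟩
  obtain ⟨r, p, rfl⟩ := exists_coords_of_integral hv hi
  rw [ip_vec] at hC
  have h : r * r + ∑ j, p j * p j ≤ N := by
    have : ((r * r + ∑ j, p j * p j : ℤ) : ℝ) ≤ N := by push_cast; linarith
    exact_mod_cast this
  have hs : 0 ≤ ∑ j, p j * p j := Finset.sum_nonneg fun _ _ => mul_self_nonneg _
  have hb : ∀ z : ℤ, z * z ≤ N → -N ≤ z ∧ z ≤ N := fun z hz =>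
    ⟨by nlinarith [mul_self_nonneg (z + 1), mul_self_nonneg z], by
      nlinarith [mul_self_nonneg (z - 1), mul_self_nonneg z]⟩
  refine ⟨(r, p), ⟨hb r (by linarith), ?_, ?_⟩, rfl⟩
  all_goals
    intro j
    have := Finset.single_le_sum (f := fun j => p j * p j) (fun _ _ => mul_self_nonneg _)
      (Finset.mem_univ j)
    have h2 := hb (p j) (by nlinarith [mul_self_nonneg r])
  · exact h2.1
  · exact h2.2

theorem even_of_algebraMap_mem_evenPart {x : ℝ} (h : algebraMap ℝ (Cliff n) x ∈ evenPart n) :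
    ∃ X : ℤ, x = 2 * X := by
  obtain ⟨j, hj, hx⟩ := h
  obtain ⟨z, hz⟩ := re_integral hj
  refine ⟨z, ?_⟩
  have := congrArg re hx
  rwa [re_algebraMap, two_mul, map_add, hz, ← two_mul] at this

/-- The sum has the form p + star p, and star p ≡ p modulo 2. -/
theorem row_form_mem_evenPart {a b e : Cliff n} (ha : a ∈ integral n) (hb : b ∈ integral n)
    (he : e ∈ integral n) : a * e * star b + b * star e * star a ∈ evenPart n := by
  have hp : a * e * star b ∈ integral n := mul_mem (mul_mem ha he) (star_mem_integral hb)
  have e1 : a * e * star b + b * star e * star a =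
      (star (a * e * star b) - a * e * star b) + 2 * (a * e * star b) := by
    rw [star_mul, star_mul, star_star]; noncomm_ring
  rw [e1]
  exact add_mem (star_sub_mem_evenPart hp) ⟨_, hp, rfl⟩

/-- In the commutative quotient modulo 2, with `star` and `rev` trivial, the expression becomes
e(ad* − bc*) − e = 0. The identity `e1` keeps track of each correction. -/
theorem offdiag_sub_mem_evenPart {a b c d e : Cliff n} (ha : a ∈ integral n) (hb : b ∈ integral n)
    (hc : c ∈ integral n) (hd : d ∈ integral n) (he : e ∈ integral n)
    (hdet : a * rev d - b * rev c = 1) :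
    a * e * star d + b * star e * star c - e ∈ evenPart n := by
  have e1 : a * e * star d + b * star e * star c - e =
      (a * e * (star d - d) + (a * e - e * a) * d - e * a * (rev d - d)) +
      (b * (star e - e) * star c + b * e * (star c - c) + (b * e - e * b) * c -
        e * b * (rev c - c)) + 2 * (e * b * rev c) := by
    nth_rw 3 [← mul_one e]
    rw [← hdet]
    noncomm_ring
  rw [e1]
  have hs : ∀ {x y : Cliff n}, x ∈ integral n → y ∈ integral n → x * y ∈ integral n :=
    fun hx hy => mul_mem hx hy
  refine add_mem (add_mem (sub_mem (add_mem ?_ ?_) ?_) (sub_mem (add_mem (add_mem ?_ ?_) ?_) ?_)) ?_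
  · exact mul_mem_evenPart_left (hs ha he) (star_sub_mem_evenPart hd)
  · exact mul_mem_evenPart_right hd (commutator_mem_evenPart ha he)
  · exact mul_mem_evenPart_left (hs he ha) (rev_sub_mem_evenPart hd)
  · exact mul_mem_evenPart_right (star_mem_integral hc)
      (mul_mem_evenPart_left hb (star_sub_mem_evenPart he))
  · exact mul_mem_evenPart_left (hs hb he) (star_sub_mem_evenPart hc)
  · exact mul_mem_evenPart_right hc (commutator_mem_evenPart hb he)
  · exact mul_mem_evenPart_left (hs he hb) (rev_sub_mem_evenPart hc)
  · exact ⟨_, hs (hs he hb) (rev_mem_integral hc), rfl⟩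

end Cliff

/-! ### The action on points and the half-spaces of a vector -/

namespace SLPlusInt

variable {n : ℕ}

/-- The matrix of an element of `SL₊(Γₙ(ℤ))`. -/
def toMat (g : SLPlusInt n) : Matrix (Fin 2) (Fin 2) (Cliff n) := g.1.1

theorem isSLPlus_toMat (g : SLPlusInt n) : IsSLPlus (toMat g) := g.2.1

theorem toMat_mem_integral (g : SLPlusInt n) (i j : Fin 2) : toMat g i j ∈ integral n :=
  (g.2.2 i j).1

theorem toMat_mul (g h : SLPlusInt n) : toMat (g * h) = toMat g * toMat h := rfl

theorem toMat_one : toMat (1 : SLPlusInt n) = 1 := rfl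

/-- The action on Hermitian matrices. -/
noncomputable def act (g : SLPlusInt n) (m : Matrix (Fin 2) (Fin 2) (Cliff n)) :
    Matrix (Fin 2) (Fin 2) (Cliff n) :=
  toMat g * m * (toMat g)ᴴ

theorem act_mul (g h : SLPlusInt n) (m : Matrix (Fin 2) (Fin 2) (Cliff n)) :
    act (g * h) m = act g (act h m) := by
  simp only [act, toMat_mul, Matrix.conjTranspose_mul, mul_assoc]

@[simp] theorem act_one (m : Matrix (Fin 2) (Fin 2) (Cliff n)) :
    act (1 : SLPlusInt n) m = m := by
  simp [act, toMat_one]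

/-- The coordinate in direction `e` of the image of a base point under an element of the modular
group. -/
noncomputable def height (e : Cliff n) (g : SLPlusInt n) : ℝ := ip (act g (herm 2 e 2) 0 1) e

/-- The elements of the modular group that map a base point to the positive side of the hyperplane
orthogonal to `e`. -/
def halfSpace (e : Cliff n) : Set (SLPlusInt n) := {g | 0 < height e g}

theorem height_eq {e : Cliff n} {g : SLPlusInt n} {a b : ℝ} {z : Cliff n}
    (h : act g (herm 2 e 2) = herm a z b) : height e g = ip z e := by
  rw [height, h]; simp [herm]

theorem mem_smul_halfSpace {e : Cliff n} {k x : SLPlusInt n} :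
    x ∈ k • halfSpace e ↔ 0 < height e (k⁻¹ * x) := by
  rw [Set.mem_smul_set_iff_inv_smul_mem]; rfl

end SLPlusInt

/-- Integral unit vectors. -/
structure IsIntegralUnitVector {n : ℕ} (e : Cliff n) : Prop where
  mem_V : e ∈ V n
  mem_integral : e ∈ integral n
  ip_self : ip e e = 1

/-! ### The walls of an integral unit vector -/

namespace IsIntegralUnitVector

open SLPlusInt

variable {n : ℕ} {e : Cliff n} (he : IsIntegralUnitVector e)
include he

/-- The image of the root is congruent to it modulo 2 and still has determinant −1. Writing v = e +
2j, the inner product with `e` is 1 plus twice an integral real part. -/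
theorem exists_root (k : SLPlusInt n) : ∃ X Y : ℤ, ∃ v ∈ V n, v ∈ integral n ∧
    act k (herm 0 e 0) = herm (2 * X) v (2 * Y) ∧ ip v v = 1 + 4 * X * Y ∧
    ∃ ε : ℤ, ip v e = 2 * ε + 1 := by
  obtain ⟨x, y, v, hv, h, -⟩ := exists_mul_herm_mul (isSLPlus_toMat k) 0 he.mem_V 0
  have hk := toMat_mem_integral k
  have h00 := congrFun (congrFun h 0) 0
  have h01 := congrFun (congrFun h 0) 1
  have h11 := congrFun (congrFun h 1) 1
  rw [mul_herm_mul] at h00 h01 h11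
  simp only [map_zero, mul_zero, zero_mul, zero_add, add_zero, herm, Matrix.of_apply,
    Matrix.cons_val', Matrix.cons_val_zero, Matrix.cons_val_one, Matrix.cons_val_fin_one]
    at h00 h01 h11
  obtain ⟨X, hX⟩ := even_of_algebraMap_mem_evenPart
    (h00 ▸ row_form_mem_evenPart (hk 0 0) (hk 0 1) he.mem_integral)
  obtain ⟨Y, hY⟩ := even_of_algebraMap_mem_evenPart
    (h11 ▸ row_form_mem_evenPart (hk 1 0) (hk 1 1) he.mem_integral)
  obtain ⟨j, hj, hve⟩ := h01 ▸ offdiag_sub_mem_evenPart (hk 0 0) (hk 0 1) (hk 1 0) (hk 1 1)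
    he.mem_integral (isSLPlus_toMat k).det_eq
  obtain ⟨z, hz⟩ := re_integral (mul_mem hj (star_mem_integral he.mem_integral))
  have hvj : v = e + j + j := by rw [sub_eq_iff_eq_add] at hve; rw [hve]; noncomm_ring
  refine ⟨X, Y, v, hv, ?_, ?_, ?_, z, ?_⟩
  · rw [hvj]; exact add_mem (add_mem he.mem_integral hj) hj
  · rw [← hX, ← hY]; exact h
  · have := form_eq_of_mul_herm_mul (isSLPlus_toMat k) he.mem_V he.mem_V hv hv h h
    rw [he.ip_self, hX, hY] at this
    linarith
  · rw [hvj, map_add, map_add, LinearMap.add_apply, LinearMap.add_apply, he.ip_self, ip_apply, hz]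
    ring

theorem exists_point (g : SLPlusInt n) : ∃ a b : ℝ, ∃ z ∈ V n,
    act g (herm 2 e 2) = herm a z b ∧ 0 < a ∧ 0 < b ∧ ip z z + 3 = a * b := by
  obtain ⟨a, b, z, hz, h, hpos⟩ := exists_mul_herm_mul (isSLPlus_toMat g) 2 he.mem_V 2
  obtain ⟨ha, hb⟩ := hpos (by norm_num) (by norm_num) (by rw [he.ip_self]; norm_num)
  have hf := form_eq_of_mul_herm_mul (isSLPlus_toMat g) he.mem_V he.mem_V hz hz h h
  rw [he.ip_self] at hf
  have hab : ip z z + 3 = a * b := by linarith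
  have h0 := ip_self_nonneg hz
  have hne : a * b ≠ 0 := by linarith
  exact ⟨a, b, z, hz, h, lt_of_le_of_ne ha (Ne.symm (left_ne_zero_of_mul hne)),
    lt_of_le_of_ne hb (Ne.symm (right_ne_zero_of_mul hne)), hab⟩

/-- The height is the pairing of a point with the root up to sign; invariance moves `k` from the
point to the root. -/
theorem height_inv_mul {k x : SLPlusInt n} {a b X Y : ℝ} {z v : Cliff n} (hz : z ∈ V n)
    (hv : v ∈ V n) (hx : act x (herm 2 e 2) = herm a z b) (hk : act k (herm 0 e 0) = herm X v Y) :
    height e (k⁻¹ * x) = ip z v - (a * Y + b * X) / 2 := by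
  obtain ⟨a', b', z', hz', h, -⟩ := he.exists_point (k⁻¹ * x)
  have h2 : act k (herm a' z' b') = herm a z b := by
    rw [← h, ← act_mul, mul_inv_cancel_left, hx]
  have := form_eq_of_mul_herm_mul (isSLPlus_toMat k) hz' he.mem_V hz hv h2 hk
  rw [height_eq h]
  linarith

theorem height_inv {k : SLPlusInt n} {X Y : ℝ} {v : Cliff n}
    (hv : v ∈ V n) (hk : act k (herm 0 e 0) = herm X v Y) :
    height e k⁻¹ = ip v e - (Y + X) := by
  have := he.height_inv_mul he.mem_V hv (act_one _) hk
  rw [mul_one] at this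
  rw [this, ip_comm he.mem_V hv]
  ring

theorem height_ne_zero (g : SLPlusInt n) : height e g ≠ 0 := by
  obtain ⟨X, Y, v, hv, -, h, -, ε, hε⟩ := he.exists_root g⁻¹
  have := he.height_inv hv h
  rw [inv_inv, hε] at this
  rw [this]
  have h1 : (2 * ε + 1 - (2 * Y + 2 * X) : ℤ) ≠ 0 := by omega
  exact_mod_cast h1

theorem smul_halfSpace_eq_of_act_eq {k k' : SLPlusInt n}
    (h : act k (herm 0 e 0) = act k' (herm 0 e 0)) : k • halfSpace e = k' • halfSpace e := by
  obtain ⟨X, Y, v, hv, -, hk, -⟩ := he.exists_root k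
  ext x
  obtain ⟨a, b, z, hz, hx, -⟩ := he.exists_point x
  rw [mem_smul_halfSpace, mem_smul_halfSpace, he.height_inv_mul hz hv hx hk,
    he.height_inv_mul hz hv hx (h ▸ hk)]

theorem one_mem_halfSpace : 1 ∈ halfSpace e := by
  change 0 < height e 1
  rw [height_eq (act_one _), he.ip_self]
  exact one_pos

/-- With ⟨v, e⟩ = 2ε + 1, the difference of the two roots has form value 4XY − |v − e|² = 4ε. If ε ≥
0 it lies in the closed light cone and pairs with all points with a constant sign, so one height
dominates the other. If ε ≤ −1 the same holds for the sum of the roots. -/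
theorem nested (k : SLPlusInt n) : k • halfSpace e ⊆ halfSpace e ∨
    halfSpace e ⊆ k • halfSpace e ∨ Disjoint (k • halfSpace e) (halfSpace e) ∨
    (k • halfSpace e)ᶜ ⊆ halfSpace e := by
  obtain ⟨X, Y, v, hv, -, hk, hvv, ε, hε⟩ := he.exists_root k
  have causal : ∀ u ∈ V n, ip u u ≤ 4 * X * Y →
      (∀ a b : ℝ, ∀ z ∈ V n, 0 < a → 0 < b → ip z z + 3 = a * b → ip z u ≤ a * Y + b * X) ∨
      (∀ a b : ℝ, ∀ z ∈ V n, 0 < a → 0 < b → ip z z + 3 = a * b → a * Y + b * X ≤ ip z u) := by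
    intro u hu huu
    have h0 := ip_self_nonneg hu
    have key : ∀ a b : ℝ, ∀ z ∈ V n, 0 < a → 0 < b → ip z z + 3 = a * b →
        (ip z u) ^ 2 / 4 ≤ a * Y * (b * X) := by
      intro a b z hz ha hb hab
      have h1 := ip_sq_le hz hu
      have h2 : ip z z * ip u u ≤ a * b * (4 * X * Y) := by
        rw [← hab]
        exact mul_le_mul (by linarith) huu h0 (by linarith [ip_self_nonneg hz])
      linarith
    have hXY : (0 : ℝ) ≤ X * Y := by linarith
    -- The signs of `X` and `Y` distinguish the future cone from the past cone.
    rcases mul_nonneg_iff.1 hXY with ⟨hX, hY⟩ | ⟨hX, hY⟩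
    · refine .inl fun a b z hz ha hb hab => ?_
      have := add_add_two_mul_nonneg (p := -(ip z u / 2)) (mul_nonneg ha.le hY)
        (mul_nonneg hb.le hX) (by have := key a b z hz ha hb hab; linarith)
      linarith
    · refine .inr fun a b z hz ha hb hab => ?_
      have := add_add_two_mul_nonneg (p := ip z u / 2)
        (mul_nonneg ha.le (neg_nonneg.2 hY)) (mul_nonneg hb.le (neg_nonneg.2 hX))
        (by have := key a b z hz ha hb hab; linarith)
      linarith
  have hsym := ip_comm he.mem_V hv
  have hee := he.ip_self
  rcases le_or_gt 0 ε with h | h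
  · have hε' : (0 : ℝ) ≤ ε := by exact_mod_cast h
    rcases causal (v - e) (sub_mem hv he.mem_V) (by
      simp only [map_sub, LinearMap.sub_apply]; linarith) with hc | hc
    · refine .inl fun x hx => ?_
      obtain ⟨a, b, z, hz, hxm, ha, hb, hab⟩ := he.exists_point x
      rw [mem_smul_halfSpace, he.height_inv_mul hz hv hxm hk] at hx
      have := hc a b z hz ha hb hab
      change 0 < height e x
      rw [height_eq hxm]
      rw [map_sub] at this
      linarith
    · refine .inr (.inl fun x hx => ?_)
      obtain ⟨a, b, z, hz, hxm, ha, hb, hab⟩ := he.exists_point x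
      change 0 < height e x at hx
      rw [height_eq hxm] at hx
      rw [mem_smul_halfSpace, he.height_inv_mul hz hv hxm hk]
      have := hc a b z hz ha hb hab
      rw [map_sub] at this
      linarith
  · have hε' : (ε : ℝ) ≤ -1 := by exact_mod_cast (by omega : ε ≤ -1)
    rcases causal (v + e) (add_mem hv he.mem_V) (by
      simp only [map_add, LinearMap.add_apply]; linarith) with hc | hc
    · refine .inr (.inr (.inl (Set.disjoint_left.2 fun x hx hx' => ?_)))
      obtain ⟨a, b, z, hz, hxm, ha, hb, hab⟩ := he.exists_point x
      rw [mem_smul_halfSpace, he.height_inv_mul hz hv hxm hk] at hx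
      change 0 < height e x at hx'
      rw [height_eq hxm] at hx'
      have := hc a b z hz ha hb hab
      rw [map_add] at this
      linarith
    · refine .inr (.inr (.inr fun x hx => ?_))
      obtain ⟨a, b, z, hz, hxm, ha, hb, hab⟩ := he.exists_point x
      rw [Set.mem_compl_iff, mem_smul_halfSpace, he.height_inv_mul hz hv hxm hk] at hx
      have := hc a b z hz ha hb hab
      rw [map_add] at this
      refine lt_of_le_of_ne ?_ (he.height_ne_zero x).symm
      rw [height_eq hxm]
      linarith

theorem finite_separating (g : SLPlusInt n) : {B : Set (SLPlusInt n) |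
    (∃ k : SLPlusInt n, k • halfSpace e = B) ∧ 1 ∈ B ∧ g ∉ B}.Finite := by
  obtain ⟨a, b, z, hz, hg, ha, hb, hab⟩ := he.exists_point g
  obtain ⟨N, hN⟩ := exists_int_gt (4 + a ^ 2 + b ^ 2)
  -- A half-space depends only on its root, so it suffices to bound `X`, `Y` and then |v|² = 1 +
  -- 4XY.
  have hfin := ((Set.finite_Icc (-N) N).prod (Set.finite_Icc (-N) N)).prod
    (finite_integral_vectors (n := n) (1 + 4 * N * N))
  refine (hfin.image fun q : (ℤ × ℤ) × Cliff n => {x : SLPlusInt n | ∃ k : SLPlusInt n,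
    act k (herm 0 e 0) = herm (2 * q.1.1) q.2 (2 * q.1.2) ∧ x ∈ k • halfSpace e}).subset ?_
  rintro _ ⟨⟨k, rfl⟩, h1, h2⟩
  obtain ⟨X, Y, v, hv, hvi, hk, hvv, -⟩ := he.exists_root k
  rw [mem_smul_halfSpace, mul_one, he.height_inv hv hk] at h1
  rw [mem_smul_halfSpace, he.height_inv_mul hz hv hg hk, not_lt] at h2
  have hz0 := ip_self_nonneg hz
  have hv0 := ip_self_nonneg hv
  have hez : 0 ≤ a + b - ip z e := by
    have h3 := ip_sq_le hz he.mem_V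
    rw [he.ip_self] at h3
    have := add_add_two_mul_nonneg (p := -(ip z e / 2)) ha.le hb.le (by nlinarith)
    linarith
  -- `α` and `-β` are the heights of the base point P and of gP over the wall, so βP + αgP lies on
  -- the wall. By `huv` it is orthogonal to the root, and by `huu` its form value is at least 3(α² +
  -- β²).
  set α := ip v e - (2 * Y + 2 * X) with hα
  set β := -(ip z v - (a * (2 * Y) + b * (2 * X)) / 2) with hβ
  have hβ0 : 0 ≤ β := by linarith
  have hu : β • e + α • z ∈ V n := add_mem ((V n).smul_mem _ he.mem_V) ((V n).smul_mem _ hz)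
  have huv : ip v (β • e + α • z) = (2 * β + α * a) * Y + (2 * β + α * b) * X := by
    rw [map_add, map_smul, map_smul, smul_eq_mul, smul_eq_mul, ip_comm hv hz]
    have e1 : ip v e = α + (2 * Y + 2 * X) := by rw [hα]; ring
    have e2 : ip z v = -β + (a * (2 * Y) + b * (2 * X)) / 2 := by rw [hβ]; ring
    rw [e1, e2]; ring
  have huu : 3 * (α ^ 2 + β ^ 2) ≤ (2 * β + α * a) * (2 * β + α * b) -
      ip (β • e + α • z) (β • e + α • z) := by
    simp only [map_add, map_smul, LinearMap.add_apply, LinearMap.smul_apply, smul_eq_mul,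
      he.ip_self, ip_comm he.mem_V hz]
    have := mul_nonneg (mul_nonneg h1.le hβ0) hez
    linear_combination 2 * this + α ^ 2 * hab
  -- With u = βe + αz, orthogonality gives |Bv − 2Tu|² = B² − 4T²(AB − |u|²). As this is
  -- nonnegative, 12(α² + β²)T² ≤ B². The constant 4 + a² + b² bounds B²/(α² + β²) for both choices
  -- of `B`, so one `N` serves `X` and `Y`.
  have hbound : ∀ (A B : ℝ) (S T : ℤ), ip v (β • e + α • z) = A * T + B * S →
      ip v v = 1 + 4 * S * T → 3 * (α ^ 2 + β ^ 2) ≤ A * B -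
        ip (β • e + α • z) (β • e + α • z) →
      B ^ 2 ≤ (4 + a ^ 2 + b ^ 2) * (α ^ 2 + β ^ 2) → -N ≤ T ∧ T ≤ N := by
    intro A B S T h1 h2 h3 h4
    have h5 := ip_self_nonneg (sub_mem ((V n).smul_mem B hv) ((V n).smul_mem (2 * T : ℝ) hu))
    generalize β • e + α • z = u at *
    simp only [map_sub, map_smul, LinearMap.sub_apply, LinearMap.smul_apply, smul_eq_mul, h1, h2,
      ip_comm hu hv] at h5
    have h6 : 12 * (α ^ 2 + β ^ 2) * (T : ℝ) ^ 2 ≤ B ^ 2 := by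
      have := mul_le_mul_of_nonneg_left h3 (sq_nonneg (T : ℝ))
      linear_combination h5 + 4 * this
    have hpos : 0 < α ^ 2 + β ^ 2 := by positivity
    have h7 : (T : ℝ) ^ 2 ≤ 4 + a ^ 2 + b ^ 2 := by
      have h8 : (T : ℝ) ^ 2 * (α ^ 2 + β ^ 2) ≤ (4 + a ^ 2 + b ^ 2) * (α ^ 2 + β ^ 2) := by
        have : 0 ≤ (α ^ 2 + β ^ 2) * (T : ℝ) ^ 2 := by positivity
        linarith
      exact le_of_mul_le_mul_right h8 hpos
    have h9 : T ^ 2 ≤ N := by exact_mod_cast (h7.trans hN.le)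
    constructor <;> nlinarith [sq_nonneg (T + 1), sq_nonneg (T - 1)]
  have hY : -N ≤ Y ∧ Y ≤ N := hbound _ _ X Y huv hvv huu (by
    nlinarith [sq_nonneg (α * 2 - β * b), mul_nonneg (sq_nonneg a) (sq_nonneg β),
      mul_nonneg (sq_nonneg a) (sq_nonneg α)])
  have hX : -N ≤ X ∧ X ≤ N := hbound (2 * β + α * b) (2 * β + α * a) Y X (by rw [huv]; ring)
    (by rw [hvv]; ring) (by linarith) (by
    nlinarith [sq_nonneg (α * 2 - β * a), mul_nonneg (sq_nonneg b) (sq_nonneg β),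
      mul_nonneg (sq_nonneg b) (sq_nonneg α)])
  refine ⟨((X, Y), v), ⟨⟨hX, hY⟩, hv, hvi, ?_⟩, ?_⟩
  · rw [hvv]
    have : X * Y ≤ N * N := by
      have hN0 : 0 ≤ N := by linarith [hX.1, hX.2]
      nlinarith [hX.1, hX.2, hY.1, hY.2]
    have : (X * Y : ℝ) ≤ N * N := by exact_mod_cast this
    linarith
  · ext x
    constructor
    · rintro ⟨k', hk', hx⟩
      rwa [he.smul_halfSpace_eq_of_act_eq (hk.trans hk'.symm)]
    · exact fun hx => ⟨k, hk, hx⟩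

/-- Put m = 2ε + 1. Separation gives −m ≤ 2(X + Y) < m, and Cauchy–Schwarz gives m² ≤ 1 + 4XY ≤ 1 +
(X + Y)². Hence X + Y = 0, then X = Y = 0 and m = 1, and v = e because |v − e|² = 0. -/
theorem act_eq_self {k τ : SLPlusInt n} (hτ' : act τ (herm 2 e 2) = herm 2 (-e) 2)
    (h1 : 1 ∈ k • halfSpace e) (h2 : τ ∉ k • halfSpace e) :
    act k (herm 0 e 0) = herm 0 e 0 := by
  obtain ⟨X, Y, v, hv, -, hk, hvv, ε, hε⟩ := he.exists_root k
  rw [mem_smul_halfSpace, mul_one, he.height_inv hv hk, hε] at h1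
  rw [mem_smul_halfSpace, he.height_inv_mul (neg_mem he.mem_V) hv hτ' hk, not_lt, map_neg,
    LinearMap.neg_apply, ip_comm he.mem_V hv, hε] at h2
  have hcs := ip_sq_le hv he.mem_V
  rw [he.ip_self, hvv, hε] at hcs
  have h1' : 0 < 2 * ε + 1 - (2 * Y + 2 * X) := by exact_mod_cast h1
  have h2' : -(2 * ε + 1) ≤ 2 * Y + 2 * X := by
    have : (-(2 * ε + 1) : ℝ) ≤ 2 * Y + 2 * X := by linarith
    exact_mod_cast this
  have hcs' : (2 * ε + 1) ^ 2 ≤ 1 + 4 * X * Y := by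
    have : ((2 * ε + 1) ^ 2 : ℝ) ≤ 1 + 4 * X * Y := by linarith
    exact_mod_cast this
  have key : ∀ S T : ℤ, 0 < 2 * ε + 1 - (2 * T + 2 * S) → -(2 * ε + 1) ≤ 2 * T + 2 * S →
      (2 * ε + 1) ^ 2 ≤ 1 + 4 * S * T → T = 0 := by
    intro S T h3 h4 h5
    rcases lt_trichotomy T 0 with h | h | h
    · nlinarith [mul_nonneg (neg_nonneg.2 h.le) (sub_nonneg.2 h4), sq_nonneg (2 * ε + 1 + T)]
    · exact h
    · nlinarith [mul_pos h h3, sq_nonneg (2 * ε + 1 - T)]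
  have hY := key X Y h1' h2' hcs'
  have hX := key Y X (by linarith) (by linarith) (by linarith)
  subst hX hY
  have hε0 : ε = 0 := by nlinarith
  subst hε0
  have h3 : v - e = 0 := eq_zero_of_ip_self (sub_mem hv he.mem_V) (by
    simp only [map_sub, LinearMap.sub_apply, ip_comm he.mem_V hv, hε, hvv, he.ip_self]
    norm_num)
  rw [hk, sub_eq_zero.1 h3]
  simp

theorem flip_notMem_halfSpace {τ : SLPlusInt n} (hτ' : act τ (herm 2 e 2) = herm 2 (-e) 2) :
    τ ∉ halfSpace e := by
  change ¬ 0 < height e τ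
  rw [height_eq hτ', map_neg, LinearMap.neg_apply, he.ip_self]
  norm_num

theorem isNestedCut {τ : SLPlusInt n} (hτ : act τ (herm 0 e 0) = herm 0 (-e) 0)
    (hτ' : act τ (herm 2 e 2) = herm 2 (-e) 2) : IsNestedCut (halfSpace e) τ where
  one_mem := he.one_mem_halfSpace
  flip := by
    ext x
    obtain ⟨a, b, z, hz, hx, -⟩ := he.exists_point x
    rw [mem_smul_halfSpace, he.height_inv_mul hz (neg_mem he.mem_V) hx hτ]
    change _ ↔ ¬ 0 < height e x
    have h0 := he.height_ne_zero x
    rw [height_eq hx] at h0 ⊢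
    rw [map_neg, mul_zero, mul_zero, add_zero, zero_div, sub_zero, neg_pos, not_lt]
    exact ⟨le_of_lt, fun h => lt_of_le_of_ne h h0⟩
  nested := he.nested
  minimal k h1 h2 := by
    have := he.act_eq_self hτ' h1 fun h => he.flip_notMem_halfSpace hτ' (h2 h)
    rw [he.smul_halfSpace_eq_of_act_eq (k' := 1) (by rw [this, act_one]), one_smul]
  finite := he.finite_separating

theorem smul_halfSpace_eq_iff {k τ : SLPlusInt n} (hτ' : act τ (herm 2 e 2) = herm 2 (-e) 2) :
    k • halfSpace e = halfSpace e ↔ act k (herm 0 e 0) = herm 0 e 0 := by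
  constructor
  · intro h
    refine he.act_eq_self hτ' ?_ ?_ <;> rw [h]
    · exact he.one_mem_halfSpace
    · exact he.flip_notMem_halfSpace hτ'
  · intro h
    rw [he.smul_halfSpace_eq_of_act_eq (k' := 1) (by rw [h, act_one]), one_smul]

theorem mem_cutVertexGroup_halfSpace {g : SLPlusInt n}
    (hg : act g (herm 2 e 2) = herm 2 e 2) : g ∈ cutVertexGroup (halfSpace e) := by
  intro k
  obtain ⟨X, Y, v, hv, -, hk, -⟩ := he.exists_root k
  rw [mem_smul_halfSpace, mem_smul_halfSpace, he.height_inv_mul he.mem_V hv hg hk,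
    he.height_inv_mul he.mem_V hv (act_one _) hk]

/-- The splitting of the modular group along the hyperplane orthogonal to `e`. -/
theorem isNontrivialAmalgam {H : Type} [Group H] (i : H →* SLPlusInt n)
    (hi : Function.Injective i)
    (hrange : ∀ k : SLPlusInt n, k ∈ i.range ↔ act k (herm 0 e 0) = herm 0 e 0)
    {τ : SLPlusInt n} (hτ : act τ (herm 0 e 0) = herm 0 (-e) 0)
    (hτ' : act τ (herm 2 e 2) = herm 2 (-e) 2) {g : SLPlusInt n}
    (hg : act g (herm 2 e 2) = herm 2 e 2) (hg' : act g (herm 0 e 0) ≠ herm 0 e 0) :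
    IsNontrivialAmalgam i :=
  (he.isNestedCut hτ hτ').isNontrivialAmalgam i hi
    (fun k => (hrange k).trans (he.smul_halfSpace_eq_iff hτ').symm)
    ⟨g, he.mem_cutVertexGroup_halfSpace hg, fun h => hg' ((he.smul_halfSpace_eq_iff hτ').1 h)⟩

end IsIntegralUnitVector

/-! ### The stabiliser of a coordinate hyperplane -/

namespace Cliff

theorem eq_top_of_gen_mul_mem {n : ℕ} {S : Submodule ℝ (Cliff n)} (h1 : 1 ∈ S)
    (hS : ∀ j, ∀ x ∈ S, gen n j * x ∈ S) : S = ⊤ := by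
  rw [eq_top_iff]
  intro x _
  induction x using CliffordAlgebra.left_induction with
  | algebraMap r => rw [Algebra.algebraMap_eq_smul_one]; exact S.smul_mem _ h1
  | add x y hx hy => exact add_mem (hx trivial) (hy trivial)
  | ι_mul x v hx =>
    have hv : v = ∑ j, v j • (Pi.single j 1 : Fin (n - 1) → ℝ) := by
      ext j; simp [Pi.single_apply]
    rw [hv, map_sum, Finset.sum_mul]
    refine sum_mem fun j _ => ?_
    rw [map_smul, smul_mul_assoc]
    exact S.smul_mem _ (hS j x (hx trivial))

theorem V_eq_top {n : ℕ} [Subsingleton (Fin (n - 1))] : V n = ⊤ := by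
  refine eq_top_of_gen_mul_mem one_mem_V fun j x hx => ?_
  have hj : gen n j ∈ V n := Submodule.subset_span (Set.mem_insert_of_mem _ ⟨j, rfl⟩)
  induction hx using Submodule.span_induction with
  | mem x hx =>
    rcases hx with rfl | ⟨l, rfl⟩
    · rwa [mul_one]
    · rw [Subsingleton.elim l j, gen_sq]
      exact neg_mem one_mem_V
  | zero => rw [mul_zero]; exact zero_mem _
  | add x y _ _ hx hy => rw [mul_add]; exact add_mem hx hy
  | smul c x _ hx => rw [mul_smul_comm]; exact (V n).smul_mem _ hx

/-- The Clifford algebra with two generators is the quaternion algebra. -/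
theorem exists_quaternion_coords (x : Cliff 3) : ∃ p q r s : ℝ,
    x = p • 1 + q • gen 3 0 + r • gen 3 1 + s • (gen 3 0 * gen 3 1) := by
  have h0 := gen_sq (n := 3) 0
  have h1 := gen_sq (n := 3) 1
  have h2 : gen 3 1 * gen 3 0 = -(gen 3 0 * gen 3 1) := gen_anticomm (by decide)
  let S : Submodule ℝ (Cliff 3) :=
    { carrier := {x | ∃ p q r s : ℝ,
        x = p • 1 + q • gen 3 0 + r • gen 3 1 + s • (gen 3 0 * gen 3 1)}
      zero_mem' := ⟨0, 0, 0, 0, by simp⟩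
      add_mem' := by
        rintro _ _ ⟨p, q, r, s, rfl⟩ ⟨p', q', r', s', rfl⟩
        exact ⟨p + p', q + q', r + r', s + s', by module⟩
      smul_mem' := by
        rintro c _ ⟨p, q, r, s, rfl⟩
        exact ⟨c * p, c * q, c * r, c * s, by module⟩ }
  have hS : S = ⊤ := by
    refine eq_top_of_gen_mul_mem ⟨1, 0, 0, 0, by simp⟩ fun j x hx => ?_
    obtain ⟨p, q, r, s, rfl⟩ := hx
    have hj : j = 0 ∨ j = 1 := by
      rcases j with ⟨j, hj⟩
      have : j = 0 ∨ j = 1 := by omega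
      rcases this with rfl | rfl
      · left; rfl
      · right; rfl
    rcases hj with rfl | rfl
    · refine ⟨-q, p, -s, r, ?_⟩
      simp only [mul_add, mul_smul_comm, mul_one, ← mul_assoc, h0]
      rw [neg_one_mul]
      module
    · refine ⟨-r, s, p, -q, ?_⟩
      have h3 : gen 3 1 * (gen 3 0 * gen 3 1) = gen 3 0 := by
        rw [← mul_assoc, h2, neg_mul, mul_assoc, h1, mul_neg, mul_one, neg_neg]
      simp only [mul_add, mul_smul_comm, mul_one, h1, h2, h3]
      module
  have : x ∈ S := hS ▸ Submodule.mem_top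
  exact this

/-- The Clifford algebras with at most two generators are `ℝ`, `ℂ` and the quaternions, and all
their elements lie in `Γ ∪ {0}`. -/
theorem mem_Gam0_of_le_three {m : ℕ} (hm : m ≤ 3) (x : Cliff m) : x ∈ Gam0 m := by
  obtain hm | rfl : m ≤ 2 ∨ m = 3 := by omega
  · have : Subsingleton (Fin (m - 1)) := Fin.subsingleton_iff_le_one.2 (by omega)
    exact mem_Gam0_of_mem_V (by rw [V_eq_top]; exact Submodule.mem_top)
  obtain ⟨p, q, r, s, hx⟩ := exists_quaternion_coords x
  have h0 := gen_sq (n := 3) 0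
  have h1 := gen_sq (n := 3) 1
  have h2 : gen 3 1 * gen 3 0 = -(gen 3 0 * gen 3 1) := gen_anticomm (by decide)
  have h3 : gen 3 0 * gen 3 1 * gen 3 0 = gen 3 1 := by
    rw [mul_assoc, h2, mul_neg, ← mul_assoc, h0, neg_one_mul, neg_neg]
  have h4 : gen 3 0 * gen 3 1 * gen 3 1 = -gen 3 0 := by rw [mul_assoc, h1, mul_neg, mul_one]
  have hV : ∀ j, gen 3 j ∈ V 3 := fun j =>
    Submodule.subset_span (Set.mem_insert_of_mem _ ⟨j, rfl⟩)
  have hsm : ∀ (c : ℝ) {x : Cliff 3}, x ∈ V 3 → c • x ∈ V 3 := fun c _ hx => (V 3).smul_mem c hx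
  -- For x = p + qi + rj + sij, right multiplication by the vector u = qi + rj removes the ij
  -- component, so `x` is the vector xu times u⁻¹. If u = 0, then x = (pi + sj)(−i).
  by_cases hqr : q ^ 2 + r ^ 2 = 0
  · have hq : q = 0 := by nlinarith [sq_nonneg q, sq_nonneg r]
    have hr : r = 0 := by nlinarith [sq_nonneg q, sq_nonneg r]
    have e : x = (p • gen 3 0 + s • gen 3 1) * -gen 3 0 := by
      rw [hx, hq, hr, mul_neg, add_mul, smul_mul_assoc, smul_mul_assoc, h0, h2]
      module
    rw [e]
    exact mul_mem_Gam0 (mem_Gam0_of_mem_V (add_mem (hsm _ (hV _)) (hsm _ (hV _))))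
      (mem_Gam0_of_mem_V (neg_mem (hV _)))
  · have hu : q • gen 3 0 + r • gen 3 1 ∈ V 3 := add_mem (hsm _ (hV _)) (hsm _ (hV _))
    have huu : (q • gen 3 0 + r • gen 3 1) * (q • gen 3 0 + r • gen 3 1) =
        (-(q ^ 2 + r ^ 2)) • (1 : Cliff 3) := by
      simp only [add_mul, mul_add, smul_mul_assoc, mul_smul_comm, h0, h1, h2]
      module
    have hxu : x * (q • gen 3 0 + r • gen 3 1) = p • (q • gen 3 0 + r • gen 3 1) +
        (-(q ^ 2 + r ^ 2)) • (1 : Cliff 3) + s • (q • gen 3 1 - r • gen 3 0) := by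
      rw [← huu, hx]
      simp only [add_mul, mul_add, smul_mul_assoc, mul_smul_comm, one_mul, h3, h4]
      module
    have e : x = x * (q • gen 3 0 + r • gen 3 1) *
        ((-(q ^ 2 + r ^ 2))⁻¹ • (q • gen 3 0 + r • gen 3 1)) := by
      rw [mul_smul_comm, mul_assoc, huu, mul_smul_comm, mul_one,
        inv_smul_smul₀ (neg_ne_zero.2 hqr)]
    rw [e, hxu]
    exact mul_mem_Gam0 (mem_Gam0_of_mem_V (add_mem (add_mem (hsm _ hu) (hsm _ one_mem_V))
      (hsm _ (sub_mem (hsm _ (hV _)) (hsm _ (hV _)))))) (mem_Gam0_of_mem_V (hsm _ hu))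

/-- For m ≤ 3 every nonzero element is a unit, so the kernel is trivial. -/
theorem cliffIncl_injective {m n : ℕ} (h : m ≤ n) (hm : m ≤ 3) :
    Function.Injective (cliffIncl h) := by
  rw [injective_iff_map_eq_zero]
  intro x hx
  rcases mem_Gam0_of_le_three hm x with h0 | ⟨u, -, rfl⟩
  · exact h0
  · exact absurd hx ((u.isUnit.map (cliffIncl h)).ne_zero)

theorem cliffIncl_involute {m n : ℕ} (h : m ≤ n) (a : Cliff m) :
    cliffIncl h (CliffordAlgebra.involute a) = CliffordAlgebra.involute (cliffIncl h a) := by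
  induction a using CliffordAlgebra.induction with
  | algebraMap r => simp
  | ι v => simp [cliffIncl]
  | mul a b ha hb => simp [ha, hb]
  | add a b ha hb => simp [ha, hb]

theorem involute_mem_integral {n : ℕ} {a : Cliff n} (ha : a ∈ integral n) :
    CliffordAlgebra.involute a ∈ integral n := by
  rw [← rev_star]
  exact rev_mem_integral (star_mem_integral ha)

/-- The last generator of the Clifford algebra. -/
noncomputable def lastGen {m n : ℕ} (hmn : n = m + 1) (hm : 1 ≤ m) : Cliff n :=
  gen n ⟨m - 1, by omega⟩

/-! ### Splitting off the last generator of the Clifford algebra -/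

section lastGen

variable {m n : ℕ} (hmn : n = m + 1) (hm : 1 ≤ m)

theorem lastGen_sq : lastGen hmn hm * lastGen hmn hm = -1 := gen_sq _

theorem lastGen_mem_V : lastGen hmn hm ∈ V n :=
  Submodule.subset_span (Set.mem_insert_of_mem _ ⟨_, rfl⟩)

theorem lastGen_mem_integral : lastGen hmn hm ∈ integral n := Subring.subset_closure ⟨_, rfl⟩

theorem star_lastGen : star (lastGen hmn hm) = -lastGen hmn hm := CliffordAlgebra.star_ι _

theorem rev_lastGen : rev (lastGen hmn hm) = lastGen hmn hm := rev_of_mem_V (lastGen_mem_V hmn hm)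

theorem isIntegralUnitVector_lastGen : IsIntegralUnitVector (lastGen hmn hm) where
  mem_V := lastGen_mem_V hmn hm
  mem_integral := lastGen_mem_integral hmn hm
  ip_self := by rw [ip_apply, star_lastGen, mul_neg, lastGen_sq, neg_neg, re_one]

theorem ι_mul_lastGen_add (v : Fin (n - 1) → ℝ) :
    CliffordAlgebra.ι (cliffordForm n) v * lastGen hmn hm +
      lastGen hmn hm * CliffordAlgebra.ι (cliffordForm n) v =
      algebraMap ℝ _ (-(2 * v ⟨m - 1, by omega⟩)) := by
  refine (CliffordAlgebra.ι_mul_ι_add_swap _ _).trans ?_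
  congr 1
  simp only [QuadraticMap.polar, cliffordForm_apply, Pi.add_apply, ← Finset.sum_neg_distrib,
    ← Finset.sum_sub_distrib]
  rw [Finset.sum_eq_single ⟨m - 1, by omega⟩]
  · simp; ring
  · intro l _ hl; simp [hl]
  · simp

theorem cliffIncl_mul_lastGen (h : m ≤ n) (y : Cliff m) :
    cliffIncl h y * lastGen hmn hm =
      lastGen hmn hm * CliffordAlgebra.involute (cliffIncl h y) := by
  induction y using CliffordAlgebra.induction with
  | algebraMap r => simp [Algebra.commutes]
  | ι v =>
    have h1 := ι_mul_lastGen_add hmn hm (formIncl h v)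
    have h2 : formIncl h v ⟨m - 1, by omega⟩ = 0 := by
      change (if hj : m - 1 < m - 1 then v ⟨m - 1, hj⟩ else 0) = 0
      simp
    rw [h2, mul_zero, neg_zero, map_zero] at h1
    simp only [cliffIncl, CliffordAlgebra.map_apply_ι, CliffordAlgebra.involute_ι, mul_neg]
    exact eq_neg_of_add_eq_zero_left h1
  | mul a b ha hb => rw [map_mul, mul_assoc, hb, ← mul_assoc, ha, mul_assoc, map_mul]
  | add a b ha hb => rw [map_add, add_mul, ha, hb, map_add, mul_add]

theorem lastGen_mul_cliffIncl (h : m ≤ n) (y : Cliff m) :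
    lastGen hmn hm * cliffIncl h y =
      cliffIncl h (CliffordAlgebra.involute y) * lastGen hmn hm := by
  rw [cliffIncl_mul_lastGen, cliffIncl_involute, CliffordAlgebra.involute_involute]

/-- Elements p + qe are closed under products: moving `e` past the smaller algebra costs the main
involution, and e² = −1. -/
theorem exists_add_mul_lastGen (h : m ≤ n) {x : Cliff n} (hx : x ∈ integral n) :
    ∃ p ∈ integral m, ∃ q ∈ integral m,
      x = cliffIncl h p + cliffIncl h q * lastGen hmn hm := by
  induction hx using Subring.closure_induction with
  | mem x hx =>
    obtain ⟨j, rfl⟩ := hx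
    by_cases hj : (j : ℕ) < m - 1
    · refine ⟨gen m ⟨j, hj⟩, Subring.subset_closure ⟨_, rfl⟩, 0, zero_mem _, ?_⟩
      rw [cliffIncl_gen, map_zero, zero_mul, add_zero]
      rfl
    · refine ⟨0, zero_mem _, 1, one_mem _, ?_⟩
      rw [map_zero, map_one, one_mul, zero_add, lastGen]
      congr 1
      ext
      have := j.2
      change (j : ℕ) = m - 1
      omega
  | zero => exact ⟨0, zero_mem _, 0, zero_mem _, by simp⟩
  | one => exact ⟨1, one_mem _, 0, zero_mem _, by simp⟩
  | add x y _ _ hx hy =>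
    obtain ⟨p, hp, q, hq, rfl⟩ := hx
    obtain ⟨p', hp', q', hq', rfl⟩ := hy
    exact ⟨p + p', add_mem hp hp', q + q', add_mem hq hq', by
      simp only [map_add, add_mul]; abel⟩
  | neg x _ hx =>
    obtain ⟨p, hp, q, hq, rfl⟩ := hx
    exact ⟨-p, neg_mem hp, -q, neg_mem hq, by simp only [map_neg, neg_mul, neg_add]⟩
  | mul x y _ _ hx hy =>
    obtain ⟨p, hp, q, hq, rfl⟩ := hx
    obtain ⟨p', hp', q', hq', rfl⟩ := hy
    refine ⟨p * p' - q * CliffordAlgebra.involute q',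
      sub_mem (mul_mem hp hp') (mul_mem hq (involute_mem_integral hq')),
      p * q' + q * CliffordAlgebra.involute p',
      add_mem (mul_mem hp hq') (mul_mem hq (involute_mem_integral hp')), ?_⟩
    calc _ = cliffIncl h p * cliffIncl h p' + cliffIncl h p * cliffIncl h q' * lastGen hmn hm +
          cliffIncl h q * (lastGen hmn hm * cliffIncl h p') +
          cliffIncl h q * (lastGen hmn hm * cliffIncl h q') * lastGen hmn hm := by noncomm_ring
      _ = cliffIncl h p * cliffIncl h p' + cliffIncl h p * cliffIncl h q' * lastGen hmn hm +
          cliffIncl h q * (cliffIncl h (CliffordAlgebra.involute p') * lastGen hmn hm) +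
          cliffIncl h q * cliffIncl h (CliffordAlgebra.involute q') *
            (lastGen hmn hm * lastGen hmn hm) := by
          rw [lastGen_mul_cliffIncl, lastGen_mul_cliffIncl]; noncomm_ring
      _ = _ := by
          rw [lastGen_sq]
          simp only [map_add, map_sub, map_mul]
          noncomm_ring

/-- For x = p + qe the terms with `p` agree, while qe contributes −q on the left and q on the right;
so 2q = 0. -/
theorem exists_cliffIncl_eq (h : m ≤ n) {x : Cliff n} (hx : x ∈ integral n)
    (hxe : x * lastGen hmn hm = lastGen hmn hm * CliffordAlgebra.involute x) :
    ∃ p ∈ integral m, cliffIncl h p = x := by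
  obtain ⟨p, hp, q, -, rfl⟩ := exists_add_mul_lastGen hmn hm h hx
  refine ⟨p, hp, ?_⟩
  have hi : CliffordAlgebra.involute (lastGen hmn hm) = -lastGen hmn hm := by
    rw [involute_of_mem_V (lastGen_mem_V hmn hm), star_lastGen]
  have h1 := cliffIncl_mul_lastGen hmn hm h p
  have h2 := cliffIncl_mul_lastGen hmn hm h q
  rw [add_mul, map_add, map_mul, hi, mul_add, ← h1, mul_neg, mul_neg, ← mul_assoc, ← h2, mul_assoc,
    lastGen_sq, add_right_inj, mul_neg, mul_one, neg_neg] at hxe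
  have h3 : (2 : ℝ) • cliffIncl h q = 0 := by
    rw [two_smul]
    nth_rw 1 [← hxe]
    exact neg_add_cancel _
  rw [(smul_eq_zero.1 h3).resolve_left two_ne_zero, zero_mul, add_zero]

theorem mem_V_of_cliffIncl_mem_V (hmn : n = m + 1) (hm : 1 ≤ m) (h : m ≤ n) (hm3 : m ≤ 3)
    {y : Cliff m}
    (hy : cliffIncl h y ∈ V n) : y ∈ V m := by
  have hc := cliffIncl_mul_lastGen hmn hm h y
  obtain ⟨r, v, hv⟩ := mem_V.1 hy
  rw [hv, map_add, CliffordAlgebra.involute_ι, AlgHom.commutes, add_mul, mul_add, Algebra.commutes,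
    add_right_inj, mul_neg, ← add_eq_zero_iff_eq_neg, ι_mul_lastGen_add,
    ← map_zero (algebraMap ℝ (Cliff n)), algebraMap_inj] at hc
  have hv0 : v ⟨m - 1, by omega⟩ = 0 := by linarith
  refine mem_V.2 ⟨r, fun j => v (Fin.castLE (Nat.sub_le_sub_right h 1) j),
    cliffIncl_injective h hm3 ?_⟩
  rw [hv, map_add, AlgHom.commutes, cliffIncl, CliffordAlgebra.map_apply_ι]
  congr 2
  ext j
  change v j = if hj : (j : ℕ) < m - 1 then v (Fin.castLE _ ⟨j, hj⟩) else 0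
  split_ifs with hj
  · rfl
  · have : j = ⟨m - 1, by omega⟩ := by
      ext
      have := j.2
      change (j : ℕ) = m - 1
      omega
    rw [this, hv0]

end lastGen

end Cliff

/-! ### The stabiliser of the last generator's root and the splitting for n ≥ 2 -/

namespace SLPlusInt

variable {n : ℕ}

/-- Elements of the modular group from their matrices. -/
noncomputable def ofMat (M : Matrix (Fin 2) (Fin 2) (Cliff n)) (hM : IsSLPlus M)
    (hi : ∀ i j, M i j ∈ integral n) : SLPlusInt n :=
  ⟨hM.isUnit.unit, hM, fun i j => ⟨hi i j, hM.entries i j⟩⟩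

@[simp] theorem toMat_ofMat (M : Matrix (Fin 2) (Fin 2) (Cliff n)) (hM : IsSLPlus M)
    (hi : ∀ i j, M i j ∈ integral n) : toMat (ofMat M hM hi) = M := rfl

theorem toMat_injective : Function.Injective (toMat (n := n)) := fun _ _ h =>
  Subtype.ext (Units.ext h)

theorem toMat_incl {m : ℕ} (h : m ≤ n) (k : SLPlusInt m) (i j : Fin 2) :
    toMat (incl h k) i j = cliffIncl h (toMat k i j) := rfl

theorem incl_injective {m : ℕ} (h : m ≤ n) (hm : m ≤ 3) : Function.Injective (incl (n := n) h) := by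
  intro k k' hk
  refine toMat_injective ?_
  ext i j
  refine cliffIncl_injective h hm ?_
  rw [← toMat_incl, ← toMat_incl, hk]

theorem herm_zero (e : Cliff n) : herm 0 e 0 = !![0, e; star e, 0] := by
  simp [herm]

/-- Moving Mᴴ to the other side makes the stabiliser condition linear in the entries. -/
theorem act_herm_zero_eq_iff {e : Cliff n} (k : SLPlusInt n) :
    act k (herm 0 e 0) = herm 0 e 0 ↔
      toMat k * herm 0 e 0 = herm 0 e 0 * twistedAdj (toMat k) := by
  have h1 := (isSLPlus_toMat k).mul_adj
  have h2 := (isSLPlus_toMat k).adj_mul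
  rw [twistedAdj_eq_adj]
  constructor
  · intro h
    nth_rw 2 [← h]
    rw [act, mul_assoc _ ((toMat k)ᴴ), ← Matrix.conjTranspose_mul, h2,
      Matrix.conjTranspose_one, mul_one]
  · intro h
    rw [act, h, mul_assoc, ← Matrix.conjTranspose_mul, h1, Matrix.conjTranspose_one, mul_one]

section lastGen

variable {m : ℕ} (hmn : n = m + 1) (hm : 1 ≤ m)

theorem act_lastGen_eq_iff (k : SLPlusInt n) :
    act k (herm 0 (lastGen hmn hm) 0) = herm 0 (lastGen hmn hm) 0 ↔
      ∀ i j, toMat k i j * lastGen hmn hm =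
        lastGen hmn hm * CliffordAlgebra.involute (toMat k i j) := by
  rw [act_herm_zero_eq_iff, twistedAdj_eq, herm_zero, star_lastGen]
  constructor
  · intro h
    have h1 := congrFun (congrFun h 0) 0
    have h2 := congrFun (congrFun h 0) 1
    have h3 := congrFun (congrFun h 1) 0
    have h4 := congrFun (congrFun h 1) 1
    simp [Matrix.mul_apply, Fin.sum_univ_two] at h1 h2 h3 h4
    intro i j
    fin_cases i <;> fin_cases j <;> assumption
  · intro h
    ext i j
    fin_cases i <;> fin_cases j <;> simp [Matrix.mul_apply, Fin.sum_univ_two, h]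

theorem mem_range_incl_iff (h : m ≤ n) (hm3 : m ≤ 3) (k : SLPlusInt n) :
    k ∈ (incl h : SLPlusInt m →* SLPlusInt n).range ↔
      act k (herm 0 (lastGen hmn hm) 0) = herm 0 (lastGen hmn hm) 0 := by
  rw [act_lastGen_eq_iff]
  constructor
  · rintro ⟨k, rfl⟩ i j
    rw [toMat_incl]
    exact cliffIncl_mul_lastGen hmn hm h _
  · intro hk
    choose N hN hNk using fun i j =>
      exists_cliffIncl_eq hmn hm h (toMat_mem_integral k i j) (hk i j)
    have hS := isSLPlus_toMat k
    have hV : ∀ {y}, cliffIncl h y ∈ V n → y ∈ V m := mem_V_of_cliffIncl_mem_V hmn hm h hm3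
    -- The conditions descend along the injective inclusion, except membership in Γ ∪ {0}, which is
    -- automatic for m ≤ 3.
    have hSN : IsSLPlus (Matrix.of N) :=
      { entries := fun i j => mem_Gam0_of_le_three hm3 _
        det_eq := cliffIncl_injective h hm3 (by
          simpa [cliffIncl_rev, hNk] using hS.det_eq)
        row₀ := hV (by simpa [cliffIncl_rev, hNk] using hS.row₀)
        row₁ := hV (by simpa [cliffIncl_rev, hNk] using hS.row₁)
        col₀ := hV (by simpa [cliffIncl_rev, hNk] using hS.col₀)
        col₁ := hV (by simpa [cliffIncl_rev, hNk] using hS.col₁) }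
    refine ⟨ofMat _ hSN hN, toMat_injective ?_⟩
    ext i j
    exact hNk i j

theorem isNontrivialAmalgam_incl (hmn : n = m + 1) (hm : 1 ≤ m) (h : m ≤ n) (hm3 : m ≤ 3) :
    IsNontrivialAmalgam (incl h : SLPlusInt m →* SLPlusInt n) := by
  have hV := lastGen_mem_V hmn hm
  have hI := lastGen_mem_integral hmn hm
  have hs := star_lastGen hmn hm
  have hr := rev_lastGen hmn hm
  have hq := lastGen_sq hmn hm
  have he := isIntegralUnitVector_lastGen hmn hm
  have hrange := mem_range_incl_iff hmn hm h hm3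
  generalize lastGen hmn hm = e at *
  have hG := mem_Gam0_of_mem_V hV
  have h2 : algebraMap ℝ (Cliff n) 2 = 1 + 1 := by rw [map_ofNat, one_add_one_eq_two]
  -- This element reverses the root and sends the base point to its mirror image.
  have hτ : IsSLPlus !![e, 0; 0, -e] :=
    { entries := fun i j => by
        fin_cases i <;> fin_cases j
        exacts [hG, zero_mem_Gam0, zero_mem_Gam0, neg_mem_Gam0 hG]
      det_eq := by simp [hr, hq]
      row₀ := by simp
      row₁ := by simp
      col₀ := by simp
      col₁ := by simp }
  -- This one fixes the base point but moves the root: the upper left entry of the image is e² + e²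
  -- = −2.
  have hg : IsSLPlus !![e, 1; 0, -e] :=
    { entries := fun i j => by
        fin_cases i <;> fin_cases j
        exacts [hG, one_mem_Gam0, zero_mem_Gam0, neg_mem_Gam0 hG]
      det_eq := by simp [hr, hq]
      row₀ := by simpa using hV
      row₁ := by simp
      col₀ := by simp
      col₁ := by simpa [hr] using hV }
  refine he.isNontrivialAmalgam _ (incl_injective h hm3) hrange
    (τ := ofMat _ hτ fun i j => by
      fin_cases i <;> fin_cases j
      exacts [hI, zero_mem _, zero_mem _, neg_mem hI])
    (g := ofMat _ hg fun i j => by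
      fin_cases i <;> fin_cases j
      exacts [hI, one_mem _, zero_mem _, neg_mem hI]) ?_ ?_ ?_ ?_
  · ext i j
    rw [act, mul_herm_mul, toMat_ofMat]
    fin_cases i <;> fin_cases j <;> simp [herm, hs, hq]
  · ext i j
    rw [act, mul_herm_mul, toMat_ofMat]
    fin_cases i <;> fin_cases j <;> simp [herm, hs, hq, h2, mul_add, add_mul]
  · ext i j
    rw [act, mul_herm_mul, toMat_ofMat]
    fin_cases i <;> fin_cases j <;> simp [herm, hs, hq, h2, mul_add, add_mul]
  · intro h0
    have h00 := congrFun (congrFun h0 0) 0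
    rw [act, mul_herm_mul, toMat_ofMat] at h00
    simp [herm, hs, hq] at h00
    have := congrArg re h00
    simp at this

end lastGen

/-! ### The classical modular group -/

theorem algebraMap_surjective_one (x : Cliff 1) : ∃ r : ℝ, x = algebraMap ℝ _ r := by
  have hx : x ∈ V 1 := by
    have : Subsingleton (Fin (1 - 1)) := Fin.subsingleton_iff_le_one.2 (by omega)
    rw [V_eq_top]; exact Submodule.mem_top
  obtain ⟨r, v, rfl⟩ := mem_V.1 hx
  have : v = 0 := by ext j; exact j.elim0
  exact ⟨r, by simp [this]⟩

theorem act_one_eq_iff (k : SLPlusInt 1) :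
    act k (herm 0 1 0) = herm 0 1 0 ↔ toMat k = 1 ∨ toMat k = -1 := by
  constructor
  · intro h
    have hS := isSLPlus_toMat k
    have hi := toMat_mem_integral k
    have hdet := hS.det_eq
    choose N hN using fun i j => algebraMap_surjective_one (toMat k i j)
    have h00 := congrFun (congrFun h 0) 0
    have h01 := congrFun (congrFun h 0) 1
    have h11 := congrFun (congrFun h 1) 1
    rw [act, mul_herm_mul] at h00 h01 h11
    have hrev : ∀ r : ℝ, rev (algebraMap ℝ (Cliff 1) r) = algebraMap ℝ (Cliff 1) r := fun r =>
      rev_of_mem_V (algebraMap_mem_V r)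
    simp only [hN, hrev, CliffordAlgebra.star_algebraMap, herm, star_one, map_zero, mul_zero,
      zero_mul, mul_one, zero_add, add_zero, Matrix.of_apply, Matrix.cons_val',
      Matrix.cons_val_zero, Matrix.cons_val_one, Matrix.cons_val_fin_one, ← map_mul, ← map_add,
      ← map_sub] at h00 h01 h11 hdet
    rw [← map_one (algebraMap ℝ (Cliff 1)), algebraMap_inj] at h01 hdet
    rw [← map_zero (algebraMap ℝ (Cliff 1)), algebraMap_inj] at h00 h11
    obtain ⟨a, ha⟩ := re_integral (hi 0 0)
    obtain ⟨d, hd⟩ := re_integral (hi 1 1)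
    rw [hN, re_algebraMap] at ha hd
    -- The determinant gives ad − bc = 1, the fixed root gives ad + bc = 1 and ab = cd = 0.
    have had : N 0 0 * N 1 1 = 1 := by linarith
    have hb : N 0 1 = 0 := by
      have : N 0 0 * N 0 1 = 0 := by linarith
      exact (mul_eq_zero.1 this).resolve_left (left_ne_zero_of_mul (had ▸ one_ne_zero))
    have hc : N 1 0 = 0 := by
      have : N 1 0 * N 1 1 = 0 := by linarith
      exact (mul_eq_zero.1 this).resolve_right (right_ne_zero_of_mul (had ▸ one_ne_zero))
    rw [ha, hd] at had
    have had' : a * d = 1 := by exact_mod_cast had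
    rcases Int.eq_one_or_neg_one_of_mul_eq_one had' with rfl | rfl
    · have : d = 1 := by linarith
      left
      ext i j
      fin_cases i <;> fin_cases j <;> simp [hN, ha, hd, hb, hc, this]
    · have : d = -1 := by linarith
      right
      ext i j
      fin_cases i <;> fin_cases j <;> simp [hN, ha, hd, hb, hc, this]
  · rintro (h | h) <;> simp [act, h]

/-- With e = 1 the walls are the lines of the Farey tessellation of the hyperbolic plane, and the
base point is the centre of an ideal triangle. The elements `τ` and `g` have orders 4 and 6: one
flips a side of the triangle, the other rotates the triangle. -/
theorem isNontrivialAmalgam_one :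
    IsNontrivialAmalgam ((Subgroup.zpowers (-1 : (Matrix (Fin 2) (Fin 2) (Cliff 1))ˣ)).subgroupOf
      (SLPlusInt 1)).subtype := by
  have he : IsIntegralUnitVector (1 : Cliff 1) :=
    { mem_V := one_mem_V, mem_integral := one_mem _, ip_self := by simp [ip_apply] }
  have h1 := one_mem_Gam0 (n := 1)
  have h0 := zero_mem_Gam0 (n := 1)
  have hV := one_mem_V (n := 1)
  have hτ : IsSLPlus (!![0, -1; 1, 0] : Matrix (Fin 2) (Fin 2) (Cliff 1)) :=
    { entries := fun i j => by
        fin_cases i <;> fin_cases j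
        exacts [h0, neg_mem_Gam0 h1, h1, h0]
      det_eq := by simp
      row₀ := by simp
      row₁ := by simp
      col₀ := by simp
      col₁ := by simp }
  have hg : IsSLPlus (!![1, -1; 1, 0] : Matrix (Fin 2) (Fin 2) (Cliff 1)) :=
    { entries := fun i j => by
        fin_cases i <;> fin_cases j
        exacts [h1, neg_mem_Gam0 h1, h1, h0]
      det_eq := by simp
      row₀ := by simpa using hV
      row₁ := by simp
      col₀ := by simpa using hV
      col₁ := by simp }
  refine he.isNontrivialAmalgam _ (Subgroup.subtype_injective _) (fun k => ?_)
    (τ := ofMat _ hτ fun i j => by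
      fin_cases i <;> fin_cases j
      exacts [zero_mem _, neg_mem (one_mem _), one_mem _, zero_mem _])
    (g := ofMat _ hg fun i j => by
      fin_cases i <;> fin_cases j
      exacts [one_mem _, neg_mem (one_mem _), one_mem _, zero_mem _]) ?_ ?_ ?_ ?_
  · rw [Subgroup.range_subtype, Subgroup.mem_subgroupOf, act_one_eq_iff, Subgroup.mem_zpowers_iff]
    constructor
    · rintro ⟨z, hz⟩
      have hk : toMat k = ((-1 : (Matrix (Fin 2) (Fin 2) (Cliff 1))ˣ) ^ z).1 := by rw [hz]; rfl
      rcases Int.even_or_odd z with hz | hz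
      · left; rw [hk, hz.neg_one_zpow]; rfl
      · right; rw [hk, hz.neg_one_zpow]; rfl
    · rintro (h | h)
      · exact ⟨0, by rw [zpow_zero]; exact Units.ext h.symm⟩
      · exact ⟨1, by rw [zpow_one]; exact Units.ext h.symm⟩
  · ext i j
    rw [act, mul_herm_mul, toMat_ofMat]
    fin_cases i <;> fin_cases j <;> simp [herm]
  · ext i j
    rw [act, mul_herm_mul, toMat_ofMat]
    fin_cases i <;> fin_cases j <;> simp [herm]
  · ext i j
    rw [act, mul_herm_mul, toMat_ofMat]
    fin_cases i <;> fin_cases j <;> simp [herm, ← one_add_one_eq_two]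
  · intro h0
    have h00 := congrFun (congrFun h0 0) 0
    rw [act, mul_herm_mul, toMat_ofMat] at h00
    simp [herm] at h00
    have := congrArg re h00
    simp at this

end SLPlusInt

theorem corollary5p7 :
    (∀ n : ℕ, 2 ≤ n → n ≤ 4 →
      IsNontrivialAmalgam (SLPlusInt.incl (Nat.sub_le n 1) : SLPlusInt (n - 1) →* SLPlusInt n)) ∧
    IsNontrivialAmalgam
      ((Subgroup.zpowers (-1 : (Matrix (Fin 2) (Fin 2) (Cliff 1))ˣ)).subgroupOf
        (SLPlusInt 1)).subtype :=
  ⟨fun _ h2 h4 => SLPlusInt.isNontrivialAmalgam_incl (by omega) (by omega) _ (by omega),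
    SLPlusInt.isNontrivialAmalgam_one⟩
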